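/- **Setting.** Let $N\ge 1$ agents solve $\min \sum_{i=1}^N f_i(x_i)$ subject to $\sum_{i=1}^N A_ix_i=c$, where $x_i\in\mathbb R^d$ $(d\ge 1)$, $A_i\in\mathbb R^{q\times d}$, $c\in\mathbb R^q$, and each $f_i:\mathbb R^d\to\mathbb R$ is differentiable, $m_i$-strongly convex ($m_i\|x-y\|^2\le\langle x-y,\nabla f_i(x)-\nabla f_i(y)\rangle$, $m_i>0$) and $\sqrt{M_i}$-smooth ($\|\nabla f_i(x)-\nabla f_i(y)\|\le\sqrt{M_i}\,\|x-y\|$). Starting from $u^0=(x^0_1,\dots,x^0_N,\lambda^0)$, the noisy first-order ADMM computes, for $k\ge 0$ and all $i$, $$x_i^{k+1}=D_i^{-1}\Big[A_i^T\Big(\lambda^k-\rho_i^{k+1}\Big(\sum_{j\ne i}A_jx_j^k-c\Big)\Big)+\Gamma_i^{k+1}x_i^k-\nabla f_i(x_i^k)\Big]+\Delta_i^{k+1},$$ $$\lambda^{k+1}=\lambda^k-\zeta\Big(\sum_{i}A_ix_i^{k+1}-c\Big),\qquad \Gamma_i^{k+1}=D_iI-A_i^T\rho_i^{k+1}A_i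 ,$$ where the $\rho_i^{k+1}$ are diagonal with positive entries and may change from round to round. Write $u^k=(x_1^k,\dots,x_N^k,\lambda^k)$, $\|u\|_G^2=\sum_iD_i\|x_i\|^2+\zeta^{-1}\|\lambda\|^2$ and $\|u\|^2=\sum_i\|x_i\|^2+\|\lambda\|^2$. Let $\sigma_{i,\max}$ and $\sigma_{i,\min}$ be the largest and the smallest nonzero singular value of $A_i$; let $\rho^{k}_{i,\max}$ be the largest diagonal entry of $\rho_i^{k}$ and $\breve\rho^{k}_{i,\max}$ the largest absolute value of an entry of $\rho_i^{k}-\rho^0I$. The parameters $\alpha,\rho^0,\zeta,D_i>0$ and the penalties are admissible: for all $i$ and $k$, $$\alpha\big(N(\rho^{k+1}_{i,\max})^2+(\breve\rho^{k+1}_{i,\max})^2\big)\sigma_{i,\max}^2<m_i,\quad D_i>\rho^{k+1}_{i,\max}\sigma_{i,\max}^2,\quad D_i>\frac{N\sigma_{i,\max}^2}{\alpha}+\sqrt{M_i},\quad \rho^0>\frac N{2\alpha},\quad \zeta<2\rho^0-\frac N\alpha .$$ Let $u^*=(x^*,\lambda^*)$ be optimal, i.e. $x^*$ is a minimizer and $\lambda^*$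 is a Lagrange multiplier, $\nabla f_i(x_i^*)=A_i^T\lambda^*$ for all $i$, chosen (as is always possible) such that $\lambda^0-\lambda^*$ lies in the range of $[A_1\cdots A_N]$. Let $\tau>0$ be a lower bound for the squares of the nonzero singular values of $[A_1\cdots A_N]$. **Theorem 3.3.** There is $p>0$ that depends only on $N$, $(m_i)$, $(M_i)$, $(D_i)$, $(\sigma_{i,\max})$, $\alpha$, $\rho^0$, $\zeta$ and $\tau$ (in particular not on $d$ or on the noise) such that the following holds for every $\hat\epsilon\in(0,1)$, with $a=\frac1{1+(1-\hat\epsilon)p}\in(0,1)$. 1. *Convergence.* For every noise sequence and all $k\ge 0$, $\;\|u^k-u^*\|_G^2\le a^k\|u^0-u^*\|_G^2+R^k$, where (terms containing $\sigma_{i,\min}$ count as $0$ if $A_i=0$) $$R^k=\sum_{i=1}^N\Big(\frac{6pD_i^2}{\zeta N\sigma_{i,\min}^2}+\frac{D_i}{\hat\epsilon p}\Big)\sum_{j=1}^ka^j\|\Delta_i^{k+1-j}\|^2 ,$$ and $R^k\to0$ if $\Delta_i^k\to0$ as $k\to\infty$ for every $i$. For the remaining parts, let $f_i$ range over a class $\mathcal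 F_i$ of functions as above with $\sup_x\|\nabla f_i(x)-\nabla\hat f_i(x)\|_\infty\le\mathscr B_\infty$ for all $f_i,\hat f_i\in\mathcal F_i$ $(\mathscr B_\infty>0)$. Let $x^0$ and the (almost surely admissible) penalties be random, with $\mathbb E\|u^0-u^*\|_G^2<\infty$ and $\lambda^0$ fixed. The noise is independent of $(x^0,\rho)$, its coordinates are independent, and those of agent $i$ have density $\frac{\beta_i}2e^{-\beta_i|y|}$. The algorithm runs for $K\ge1$ rounds with output $x^{[0:K]}_{[1:N]}$. It is $(\epsilon,\delta)$-LDP if replacing one single $f_i$ by any $\hat f_i\in\mathcal F_i$ changes the probability of each event $S$ about the output so that $\Pr[S]\le e^{\epsilon}\Pr'[S]+\delta$ and $\Pr'[S]\le e^\epsilon\Pr[S]+\delta$; $\epsilon$-LDP is the case $\delta=0$. Put $$\Theta=\frac{2a}{1-a}\max_i\Big(\frac{6p}{\zeta N\sigma_{i,\min}^2}+\frac1{\hat\epsilon pD_i}\Big),\qquad C_e=\max\Big\{\zeta,\max_i\frac1{D_i}\Big\}(1+\Theta)\Big(2+\frac1{\log(1/a)}\Big)^e .$$ 2. *$\epsilon$-LDP,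 error $\widetilde O(d^3N\mathscr B_\infty^2/\epsilon^2)$.* Let $\epsilon>0$, $\beta_i=\frac{\epsilon D_i}{\mathscr B_\infty Kd}$ and $Y=\frac{d^3N\mathscr B_\infty^2}{\epsilon^2}$. Then the algorithm is $\epsilon$-LDP, the errors below are integrable, and $$\mathbb E\|u^K-u^*\|_G^2\le a^K\,\mathbb E\|u^0-u^*\|_G^2+\Theta K^2Y .$$ If $\mathbb E\|u^0-u^*\|_G^2\le V$ and $K=1+\big\lceil\log(1+V/Y)/\log(1/a)\big\rceil$, then $\mathbb E\|u^K-u^*\|^2\le C_2\,Y\,(1+\log(1+V/Y))^2$. 3. *$(\epsilon,\delta)$-LDP, error $\widetilde O(d^2N\mathscr B_\infty^2/\epsilon^2)$.* Let $0<\epsilon\le1$, $0<\delta<1$, $s=1+2\log(1/\delta)$, $\beta_i=\frac{\epsilon D_i}{\mathscr B_\infty\sqrt{Kd\,s}}$ and $Y=\frac{d^2N\mathscr B_\infty^2}{\epsilon^2}$. Then the algorithm is $(\epsilon,\delta)$-LDP, the errors below are integrable, and $$\mathbb E\|u^K-u^*\|_G^2\le a^K\,\mathbb E\|u^0-u^*\|_G^2+\Theta\,s\,K\,Y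 .$$ If $\mathbb E\|u^0-u^*\|_G^2\le V$ and $K=1+\big\lceil\log(1+V/Y)/\log(1/a)\big\rceil$, then $\mathbb E\|u^K-u^*\|^2\le C_1\,s\,Y\,(1+\log(1+V/Y))$. -/

import Mathlib

open MeasureTheory ProbabilityTheory Filter Topology

noncomputable section

namespace PrivateADMM

/-- `ℝⁿ` with the `l₂` norm. -/
abbrev Vec (n : ℕ) : Type := EuclideanSpace ℝ (Fin n)

/-- `f` is differentiable, `m`-strongly convex and `√M`-smooth on `ℝᵈ`. -/
structure StronglyConvexSmooth {d : ℕ} (m M : ℝ) (f : Vec d → ℝ) : Prop where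
  differentiable : Differentiable ℝ f
  stronglyConvex : ∀ x y : Vec d,
    m * ‖x - y‖ ^ 2 ≤ inner ℝ (x - y) (gradient f x - gradient f y)
  smooth : ∀ x y : Vec d, ‖gradient f x - gradient f y‖ ≤ √M * ‖x - y‖

/-- Smallest nonzero singular value of `T` (singular values are listed in decreasing order with
multiplicity and exactly the first `rank T` of them are nonzero); it is `0` if `T = 0`. -/
def sigmaMin {d q : ℕ} (T : Vec d →L[ℝ] Vec q) : ℝ :=
  (T : Vec d →ₗ[ℝ] Vec q).singularValues
    (Module.finrank ℝ (LinearMap.range (T : Vec d →ₗ[ℝ] Vec q)) - 1)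

/-- The diagonal matrix with diagonal `r` applied to `v`. -/
def diagMul {q : ℕ} (r : Fin q → ℝ) (v : Vec q) : Vec q :=
  WithLp.toLp 2 (fun j => r j * v j)

/-- A state `u = (x₁, …, x_N, λ)`: primal variables and multiplier. -/
abbrev State (N d q : ℕ) : Type := (Fin N → Vec d) × Vec q

/-- `‖u‖_G² = ∑ᵢ Dᵢ ‖xᵢ‖² + ζ⁻¹ ‖λ‖²`, that is, `G = diag(D₁ I, …, D_N I, ζ⁻¹ I)`. -/
def gNormSq {N d q : ℕ} (D : Fin N → ℝ) (ζ : ℝ) (u : State N d q) : ℝ :=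
  ∑ i, D i * ‖u.1 i‖ ^ 2 + ζ⁻¹ * ‖u.2‖ ^ 2

/-- `‖u‖² = ∑ᵢ ‖xᵢ‖² + ‖λ‖²`. -/
def l2NormSq {N d q : ℕ} (u : State N d q) : ℝ :=
  ∑ i, ‖u.1 i‖ ^ 2 + ‖u.2‖ ^ 2

/-- `u = (x, λ)` is optimal for `min ∑ᵢ fᵢ(xᵢ)` subject to `∑ᵢ Aᵢ xᵢ = c`: `x` is a minimizer and
`λ` is a Lagrange multiplier for it. -/
structure IsOptimum {N d q : ℕ} (A : Fin N → Vec d →L[ℝ] Vec q) (c : Vec q)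
    (f : Fin N → Vec d → ℝ) (u : State N d q) : Prop where
  feasible : ∑ i, A i (u.1 i) = c
  minimal : ∀ y : Fin N → Vec d, ∑ i, A i (y i) = c → ∑ i, f i (u.1 i) ≤ ∑ i, f i (y i)
  multiplier : ∀ i, gradient (f i) (u.1 i) = ContinuousLinearMap.adjoint (A i) u.2

/-- `Γᵢ = Dᵢ I - Aᵢᵀ ρᵢ Aᵢ`, where `ρᵢ` is the diagonal matrix with diagonal `r`. -/
def Gam {d q : ℕ} (A : Vec d →L[ℝ] Vec q) (D : ℝ) (r : Fin q → ℝ) (x : Vec d) : Vec d :=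
  D • x - ContinuousLinearMap.adjoint A (diagMul r (A x))

/-- The noisy first-order update of `xᵢ`:
`Dᵢ⁻¹ [Aᵢᵀ (λ - ρᵢ (∑_{j ≠ i} Aⱼ xⱼ - c)) + Γᵢ xᵢ - ∇fᵢ(xᵢ)] + Δᵢ`. -/
def primalStep {N d q : ℕ} (A : Fin N → Vec d →L[ℝ] Vec q) (c : Vec q) (D : Fin N → ℝ)
    (f : Fin N → Vec d → ℝ) (r : Fin N → Fin q → ℝ) (noise : Fin N → Vec d)
    (u : State N d q) (i : Fin N) : Vec d :=
  (D i)⁻¹ • (ContinuousLinearMap.adjoint (A i)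
        (u.2 - diagMul (r i) (∑ j ∈ Finset.univ.erase i, A j (u.1 j) - c))
      + Gam (A i) (D i) (r i) (u.1 i) - gradient (f i) (u.1 i)) + noise i

/-- One round: all agents update `xᵢ` in parallel, then `λ := λ - ζ (∑ᵢ Aᵢ xᵢ - c)` with the new
`xᵢ`. -/
def step {N d q : ℕ} (A : Fin N → Vec d →L[ℝ] Vec q) (c : Vec q) (D : Fin N → ℝ) (ζ : ℝ)
    (f : Fin N → Vec d → ℝ) (r : Fin N → Fin q → ℝ) (noise : Fin N → Vec d)
    (u : State N d q) : State N d q :=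
  (primalStep A c D f r noise u,
    u.2 - ζ • (∑ i, A i (primalStep A c D f r noise u i) - c))

/-- The iterates `uᵏ`; round `k + 1` uses the penalties `ρ (k + 1)` and the noise
`noise (k + 1)`. -/
def iter {N d q : ℕ} (A : Fin N → Vec d →L[ℝ] Vec q) (c : Vec q) (D : Fin N → ℝ) (ζ : ℝ)
    (f : Fin N → Vec d → ℝ) (ρ : ℕ → Fin N → Fin q → ℝ) (noise : ℕ → Fin N → Vec d)
    (u0 : State N d q) : ℕ → State N d q
  | 0 => u0
  | k + 1 => step A c D ζ f (ρ (k + 1)) (noise (k + 1)) (iter A c D ζ f ρ noise u0 k)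

/-- The part of the admissible parameter range that constrains the diagonals `r i` of the penalty
matrices `ρᵢ` of one round. The norm on `Fin q → ℝ` is the maximum norm, so that `‖r i‖` is the
largest diagonal entry of `ρᵢ` and `‖r i - ρ₀‖` the largest absolute entry of `ρᵢ - ρ₀ I`. -/
structure Admissible {N q : ℕ} (m D σ : Fin N → ℝ) (α ρ₀ : ℝ) (r : Fin N → Fin q → ℝ) :
    Prop where
  pos : ∀ i j, 0 < r i j
  penalty : ∀ i, ‖r i‖ * σ i ^ 2 < D i
  curvature : ∀ i,
    α * (N * ‖r i‖ ^ 2 * σ i ^ 2 + ‖r i - fun _ => ρ₀‖ ^ 2 * σ i ^ 2) < m i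

/-- The contraction factor `a = 1 / (1 + (1 - θ) p)`. -/
def rate (p θ : ℝ) : ℝ := 1 / (1 + (1 - θ) * p)

/-- `6 p Dᵢ² / (ζ N σ²_{i,min}) + Dᵢ / (θ p)`; the first summand counts as `0` if `Aᵢ = 0`. -/
def noiseCoeff {N d q : ℕ} (A : Fin N → Vec d →L[ℝ] Vec q) (D : Fin N → ℝ) (ζ p θ : ℝ)
    (i : Fin N) : ℝ :=
  6 * p * D i ^ 2 / (ζ * N * sigmaMin (A i) ^ 2) + D i / (θ * p)

/-- The residual `Rᵏ = ∑ᵢ coeffᵢ ∑_{j=1}^k aʲ ‖Δᵢ^{k+1-j}‖²`. -/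
def residual {N d q : ℕ} (A : Fin N → Vec d →L[ℝ] Vec q) (D : Fin N → ℝ) (ζ p θ : ℝ)
    (noise : ℕ → Fin N → Vec d) (k : ℕ) : ℝ :=
  ∑ i, noiseCoeff A D ζ p θ i *
    ∑ j ∈ Finset.Icc 1 k, rate p θ ^ j * ‖noise (k + 1 - j) i‖ ^ 2

/-- The Laplace distribution with density `β/2 · exp(-β |y|)`. -/
def laplaceMeasure (β : ℝ) : Measure ℝ :=
  volume.withDensity (fun y => ENNReal.ofReal (β / 2 * Real.exp (-(β * |y|))))

/-- Local sensitivity `B` in the maximum norm: the gradients of any two candidates in the same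
class `F i` differ by at most `B` in every coordinate, at every point. -/
def HasSensitivity {N d : ℕ} (F : Fin N → Set (Vec d → ℝ)) (B : ℝ) : Prop :=
  ∀ i, ∀ f ∈ F i, ∀ g ∈ F i, ∀ (x : Vec d) (l : Fin d), |gradient f x l - gradient g x l| ≤ B

/-- `(ε, δ)`-local differential privacy of the randomized algorithm `f ↦ X f`: whenever the private
function of one single agent `i` is replaced by another candidate `g ∈ F i`, the probability of any
event concerning the output changes by at most a factor `exp ε`, up to `δ`. -/
def IsLDP {N d : ℕ} {Ω 𝓧 : Type*} [MeasurableSpace Ω] [MeasurableSpace 𝓧] (μ : Measure Ω)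
    (F : Fin N → Set (Vec d → ℝ)) (X : (Fin N → Vec d → ℝ) → Ω → 𝓧) (ε δ : ℝ) : Prop :=
  ∀ f : Fin N → Vec d → ℝ, (∀ j, f j ∈ F j) → ∀ i, ∀ g ∈ F i, ∀ S : Set 𝓧, MeasurableSet S →
    μ (X f ⁻¹' S) ≤
        ENNReal.ofReal (Real.exp ε) * μ (X (Function.update f i g) ⁻¹' S) + ENNReal.ofReal δ ∧
      μ (X (Function.update f i g) ⁻¹' S) ≤
        ENNReal.ofReal (Real.exp ε) * μ (X f ⁻¹' S) + ENNReal.ofReal δ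

/-- The output `x_{[1:N]}^{[0:K]}` that is exposed in `K` rounds. -/
def transcript {N d q : ℕ} {Ω : Type*} (A : Fin N → Vec d →L[ℝ] Vec q) (c : Vec q)
    (D : Fin N → ℝ) (ζ : ℝ) (lam0 : Vec q) (K : ℕ) (x0 : Ω → Fin N → Vec d)
    (ρ : Ω → ℕ → Fin N → Fin q → ℝ) (noise : Ω → ℕ → Fin N → Vec d)
    (f : Fin N → Vec d → ℝ) (ω : Ω) : Fin (K + 1) → Fin N → Vec d :=
  fun k => (iter A c D ζ f (ρ ω) (noise ω) (x0 ω, lam0) k).1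

/-- The randomness of a run: the initial point and the penalties are random and lie (the penalties,
almost surely) in the admissible range; the noise coordinates are independent, those of agent `i`
follow `laplaceMeasure (β i)`, and the noise is independent of initial point and penalties. -/
structure IsLaplaceRun {N d q : ℕ} {Ω : Type*} [MeasurableSpace Ω] (μ : Measure Ω)
    (m D σ : Fin N → ℝ) (α ρ₀ : ℝ) (β : Fin N → ℝ) (x0 : Ω → Fin N → Vec d)
    (ρ : Ω → ℕ → Fin N → Fin q → ℝ) (noise : Ω → ℕ → Fin N → Vec d) : Prop where
  measurable_x0 : Measurable x0
  measurable_ρ : Measurable ρ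
  measurable_noise : Measurable noise
  admissible : ∀ᵐ ω ∂μ, ∀ k, Admissible m D σ α ρ₀ (ρ ω (k + 1))
  law : ∀ k i l, μ.map (fun ω => noise ω k i l) = laplaceMeasure (β i)
  indep : iIndepFun (fun (t : ℕ × Fin N × Fin d) ω => noise ω t.1 t.2.1 t.2.2) μ
  indep_param : IndepFun (fun ω => (x0 ω, ρ ω)) noise μ

/-- `Θ = 2 a / (1 - a) · maxᵢ (6 p / (ζ N σ²_{i,min}) + 1 / (θ p Dᵢ))`. -/
def lossConst {N d q : ℕ} (A : Fin N → Vec d →L[ℝ] Vec q) (D : Fin N → ℝ) (ζ p θ : ℝ) : ℝ :=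
  2 * (rate p θ / (1 - rate p θ)) *
    ⨆ i, (6 * p / (ζ * N * sigmaMin (A i) ^ 2) + 1 / (θ * p * D i))

/-- `C_e = max {ζ, maxᵢ 1 / Dᵢ} · (1 + Θ) · (2 + 1 / log (1 / a)) ^ e`. -/
def softConst {N d q : ℕ} (A : Fin N → Vec d →L[ℝ] Vec q) (D : Fin N → ℝ) (ζ p θ : ℝ)
    (e : ℕ) : ℝ :=
  max ζ (⨆ i, 1 / D i) * (1 + lossConst A D ζ p θ) *
    (2 + 1 / Real.log (1 / rate p θ)) ^ e

/-- The number of rounds `1 + ⌈log (1 + V / Y) / log (1 / a)⌉`. -/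
def horizon (a V Y : ℝ) : ℕ := 1 + ⌈Real.log (1 + V / Y) / Real.log (1 / a)⌉₊

end PrivateADMM

end

open PrivateADMM

noncomputable section

namespace PrivateADMM

open scoped ENNReal

/-! ### Quadratic bounds from bounds on the gradient -/

/-! Convergence rests on an energy argument for the error `u - u*` in the `G`-norm. Write `y`, `y'`
for the primal errors before and after a noiseless round and `b'` for the constraint residual after
it. Expanding the squares, the inner products of the dual error with `b'` cancel between the primal
and the dual part. What remains is a gradient term, bounded below by strong convexity and
smoothness, and a penalty term, bounded below by Young's inequality. Admissibility says that the
losses are absorbed, so the energy drops by at least a multiple of `Q = ∑ (‖y' - y‖² + ‖y‖²)`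
(`exact_descent`). Conversely the energy after the round is at most a multiple of `Q`
(`exact_upper`): the update equation expresses `Aᵢᵀ` of the new dual error through primal
quantities, and that error stays in the range of `[A₁ ⋯ A_N]`, where `τ` bounds these adjoints from
below. Together this is a contraction whose factor uses scalar constants only.

Noise is an additive perturbation of a noiseless round. Another use of Young's inequality gives away
half of the gain (`exists_contraction`), and unrolling the recursion produces the residual.

For privacy, replacing `fᵢ` by `g` has the same effect on a round as shifting the noise of agent `i`
by `Dᵢ⁻¹ (∇g - ∇fᵢ)`, taken at the current point and hence determined by the history. The likelihood
ratio of the two runs is therefore the exponential of a sum of Laplace losses, one for each round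
and coordinate, each at most `c = βᵢ B / Dᵢ` in absolute value. With `c = ε / (K d)` the total never
exceeds `ε`. For `(ε, δ)`-LDP it is enough that the total exceeds `ε` with probability at most `δ`
(`measure_evolve_le`). A loss `l` with `|l| ≤ c` and `E exp (-l) = 1` satisfies `E exp (t l) ≤ exp
(t (t + 1) c² / 2)` (`integral_exp_mul_loss_le`); this bound multiplies over coordinates and
adaptive rounds, and a Chernoff bound finishes.

For utility, the expected residual is a geometric sum of the second moments `2 / βᵢ²`, and the
horizon is just long enough for the initial error to fall below `Y`. -/

theorem add_half_le_of_deriv_ge {h h' : ℝ → ℝ} {c : ℝ} (hd : ∀ t, HasDerivAt h (h' t) t)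
    (hc : ∀ t, 0 < t → h' 0 + c * t ≤ h' t) : h 0 + h' 0 + c / 2 ≤ h 1 := by
  have hg : ∀ t, HasDerivAt (fun t => h t - h' 0 * t - c / 2 * t ^ 2)
      (h' t - h' 0 - c * t) t := by
    intro t
    have h1 := ((hd t).sub ((hasDerivAt_id t).const_mul (h' 0))).sub
      (((hasDerivAt_id t).pow 2).const_mul (c / 2))
    refine h1.congr_deriv ?_
    simp
    ring
  have hmono : MonotoneOn (fun t => h t - h' 0 * t - c / 2 * t ^ 2) (Set.Icc (0 : ℝ) 1) := by
    refine monotoneOn_of_deriv_nonneg (convex_Icc 0 1)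
      (fun t _ => (hg t).continuousAt.continuousWithinAt)
      (fun t _ => (hg t).differentiableAt.differentiableWithinAt) ?_
    intro t ht
    rw [interior_Icc] at ht
    rw [(hg t).deriv]
    linarith [hc t ht.1]
  have := hmono (Set.left_mem_Icc.2 zero_le_one) (Set.right_mem_Icc.2 zero_le_one) zero_le_one
  simp at this
  linarith

section Gradient

variable {d : ℕ} {m M : ℝ} {f : Vec d → ℝ}

theorem hasDerivAt_comp_line (hf : Differentiable ℝ f) (x v : Vec d) (t : ℝ) :
    HasDerivAt (fun s : ℝ => f (x + s • v)) (inner ℝ (gradient f (x + t • v)) v) t := by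
  have h1 : HasDerivAt (fun s : ℝ => x + s • v) v t := by
    simpa using ((hasDerivAt_id t).smul_const v).const_add x
  have h2 := ((hf (x + t • v)).hasGradientAt.hasFDerivAt).comp_hasDerivAt t h1
  exact h2.congr_deriv (InnerProductSpace.toDual_apply_apply ..)

theorem StronglyConvexSmooth.lower (hf : StronglyConvexSmooth m M f) (x y : Vec d) :
    f x + inner ℝ (gradient f x) (y - x) + m / 2 * ‖y - x‖ ^ 2 ≤ f y := by
  have h := add_half_le_of_deriv_ge (c := m * ‖y - x‖ ^ 2)
    (hasDerivAt_comp_line hf.differentiable x (y - x)) (by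
      intro t ht
      have h1 := hf.stronglyConvex (x + t • (y - x)) x
      rw [add_sub_cancel_left, norm_smul, real_inner_smul_left, inner_sub_right,
        real_inner_comm, real_inner_comm (gradient f x), Real.norm_of_nonneg ht.le] at h1
      have h2 : t * (m * ‖y - x‖ ^ 2 * t) ≤
          t * (inner ℝ (gradient f (x + t • (y - x))) (y - x) - inner ℝ (gradient f x) (y - x)) := by
        calc _ = m * (t * ‖y - x‖) ^ 2 := by ring
          _ ≤ _ := h1
      have h3 := le_of_mul_le_mul_left h2 ht
      simp only [zero_smul, add_zero]
      linarith)
  simp only [zero_smul, add_zero, one_smul, add_sub_cancel] at h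
  linarith

theorem StronglyConvexSmooth.upper (hf : StronglyConvexSmooth m M f) (x y : Vec d) :
    f y ≤ f x + inner ℝ (gradient f x) (y - x) + √M / 2 * ‖y - x‖ ^ 2 := by
  have h := add_half_le_of_deriv_ge (c := -(√M * ‖y - x‖ ^ 2))
    (fun t => (hasDerivAt_comp_line hf.differentiable x (y - x) t).neg) (by
      intro t ht
      have h1 := hf.smooth (x + t • (y - x)) x
      rw [add_sub_cancel_left, norm_smul, Real.norm_of_nonneg ht.le] at h1
      have h2 := real_inner_le_norm (gradient f (x + t • (y - x)) - gradient f x) (y - x)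
      rw [inner_sub_left] at h2
      have h3 := mul_le_mul_of_nonneg_right h1 (norm_nonneg (y - x))
      simp only [zero_smul, add_zero]
      linarith)
  simp only [zero_smul, add_zero, one_smul, add_sub_cancel, Pi.neg_apply] at h
  linarith

/-- The algorithm evaluates the gradient at the old iterate `x`, while the energy identity pairs it
with the new error `y - z`. Adding the smoothness bound from `x` to `y` and the strong convexity
bounds from `x` to `z` and from `z` to `y` cancels all function values. -/
theorem StronglyConvexSmooth.three_point (hf : StronglyConvexSmooth m M f) (z x y : Vec d) :
    m * ‖y - z‖ ^ 2 + m * ‖x - z‖ ^ 2 - √M * ‖y - x‖ ^ 2 ≤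
      2 * inner ℝ (gradient f x - gradient f z) (y - z) := by
  have h1 := hf.upper x y
  have h2 := hf.lower x z
  have h3 := hf.lower z y
  have h4 : inner ℝ (gradient f x) (y - z) =
      inner ℝ (gradient f x) (y - x) - inner ℝ (gradient f x) (z - x) := by
    rw [← inner_sub_right]; congr 1; abel
  rw [inner_sub_left, h4]
  rw [norm_sub_rev z x] at h2
  linarith

theorem StronglyConvexSmooth.continuous_gradient (hf : StronglyConvexSmooth m M f) :
    Continuous (gradient f) := by
  have : LipschitzWith (Real.toNNReal √M) (gradient f) :=
    LipschitzWith.of_dist_le_mul fun x y => by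
      simpa [dist_eq_norm, Real.sqrt_nonneg] using hf.smooth x y
  exact this.continuous

end Gradient

/-! ### Diagonal matrices and the `G`-norm -/

section DiagMul

variable {q : ℕ}

@[simp] theorem diagMul_apply (r : Fin q → ℝ) (v : Vec q) (j : Fin q) :
    diagMul r v j = r j * v j := rfl

theorem diagMul_add (r : Fin q → ℝ) (v w : Vec q) :
    diagMul r (v + w) = diagMul r v + diagMul r w := by
  ext j; simp [mul_add]

theorem diagMul_sub_const (r : Fin q → ℝ) (s : ℝ) (v : Vec q) :
    diagMul (r - fun _ => s) v = diagMul r v - s • v := by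
  ext j; simp [sub_mul]

theorem norm_diagMul_le (r : Fin q → ℝ) (v : Vec q) : ‖diagMul r v‖ ≤ ‖r‖ * ‖v‖ := by
  refine abs_le_of_sq_le_sq' ?_ (by positivity) |>.2
  rw [mul_pow, EuclideanSpace.norm_sq_eq, EuclideanSpace.norm_sq_eq, Finset.mul_sum]
  refine Finset.sum_le_sum fun j _ => ?_
  rw [diagMul_apply, norm_mul, mul_pow]
  gcongr
  exact norm_le_pi_norm r j

end DiagMul

theorem norm_add_sq_le {E : Type*} [NormedAddCommGroup E] [InnerProductSpace ℝ E] {s : ℝ}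
    (hs : 0 < s) (a b : E) : ‖a + b‖ ^ 2 ≤ (1 + s) * ‖a‖ ^ 2 + (1 + 1 / s) * ‖b‖ ^ 2 := by
  have h1 : ‖a + b‖ ^ 2 ≤ (‖a‖ + ‖b‖) ^ 2 := by gcongr; exact norm_add_le a b
  have h2 : 2 * (‖a‖ * ‖b‖) ≤ s * ‖a‖ ^ 2 + 1 / s * ‖b‖ ^ 2 := by
    have h3 : s * ‖a‖ ^ 2 + 1 / s * ‖b‖ ^ 2 - 2 * (‖a‖ * ‖b‖) =
        (s * ‖a‖ - ‖b‖) ^ 2 / s := by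
      field_simp; ring
    have : 0 ≤ (s * ‖a‖ - ‖b‖) ^ 2 / s := by positivity
    linarith
  nlinarith

theorem norm_sum_sq_le {E : Type*} [NormedAddCommGroup E] {N : ℕ} (v : Fin N → E) :
    ‖∑ i, v i‖ ^ 2 ≤ N * ∑ i, ‖v i‖ ^ 2 := by
  calc ‖∑ i, v i‖ ^ 2 ≤ (∑ i, ‖v i‖) ^ 2 := by gcongr; exact norm_sum_le _ _
    _ ≤ _ := by simpa using sq_sum_le_card_mul_sum_sq (s := Finset.univ) (f := fun i => ‖v i‖)

section GNorm

variable {N d q : ℕ} {D : Fin N → ℝ} {ζ : ℝ}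

theorem gNormSq_nonneg (hD : ∀ i, 0 < D i) (hζ : 0 < ζ) (u : State N d q) :
    0 ≤ gNormSq D ζ u := by
  unfold gNormSq
  have : ∀ i ∈ Finset.univ, 0 ≤ D i * ‖u.1 i‖ ^ 2 := fun i _ =>
    mul_nonneg (hD i).le (sq_nonneg _)
  have := Finset.sum_nonneg this
  positivity

theorem gNormSq_add_le (hD : ∀ i, 0 < D i) (hζ : 0 < ζ) {s : ℝ} (hs : 0 < s)
    (u v : State N d q) :
    gNormSq D ζ (u + v) ≤ (1 + s) * gNormSq D ζ u + (1 + 1 / s) * gNormSq D ζ v := by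
  unfold gNormSq
  have h1 : ∑ i, D i * ‖(u + v).1 i‖ ^ 2 ≤
      ∑ i, ((1 + s) * (D i * ‖u.1 i‖ ^ 2) + (1 + 1 / s) * (D i * ‖v.1 i‖ ^ 2)) := by
    refine Finset.sum_le_sum fun i _ => ?_
    have := mul_le_mul_of_nonneg_left (norm_add_sq_le hs (u.1 i) (v.1 i)) (hD i).le
    simp only [Prod.fst_add, Pi.add_apply]
    linarith
  have h2 := mul_le_mul_of_nonneg_left (norm_add_sq_le hs u.2 v.2) (inv_nonneg.2 hζ.le)
  rw [Finset.sum_add_distrib, ← Finset.mul_sum, ← Finset.mul_sum] at h1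
  simp only [Prod.snd_add]
  linarith

end GNorm

/-! ### One round without noise -/

section Exact

variable {N d q : ℕ} {A : Fin N → Vec d →L[ℝ] Vec q} {m L D σ : Fin N → ℝ} {α ρ₀ ζ : ℝ}

/-- Lower bound for the penalty term of agent `i` in the energy identity. -/
theorem penalty_lower (hα : 0 < α) (hA : ∀ i, ‖A i‖ = σ i) (r : Fin q → ℝ) (i : Fin N)
    (w : Fin N → Vec d) (y : Vec d) (b b' : Vec q) (hb : b' = b + ∑ j, A j (w j)) :
    2 * ρ₀ * inner ℝ b' (A i y) - 1 / α * ‖b'‖ ^ 2 - 1 / α * ∑ j, σ j ^ 2 * ‖w j‖ ^ 2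
        - α * (N * ‖r‖ ^ 2 * σ i ^ 2 + ‖r - fun _ => ρ₀‖ ^ 2 * σ i ^ 2) * ‖y‖ ^ 2 ≤
      2 * inner ℝ (diagMul r b) (A i y) := by
  have young : ∀ s t : ℝ, 2 * (s * t) ≤ 1 / α * s ^ 2 + α * t ^ 2 := by
    intro s t
    have h : 1 / α * s ^ 2 + α * t ^ 2 - 2 * (s * t) = (s - α * t) ^ 2 / α := by
      field_simp; ring
    have : 0 ≤ (s - α * t) ^ 2 / α := by positivity
    linarith
  have hAy : ‖A i y‖ ≤ σ i * ‖y‖ := hA i ▸ (A i).le_opNorm y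
  have h1 : -(2 * inner ℝ (diagMul (r - fun _ => ρ₀) b') (A i y)) ≤
      1 / α * ‖b'‖ ^ 2 + α * (‖r - fun _ => ρ₀‖ * (σ i * ‖y‖)) ^ 2 := by
    have h := (abs_le.1 (abs_real_inner_le_norm (diagMul (r - fun _ => ρ₀) b') (A i y))).1
    have h' : ‖diagMul (r - fun _ => ρ₀) b'‖ * ‖A i y‖ ≤
        (‖r - fun _ => ρ₀‖ * ‖b'‖) * (σ i * ‖y‖) := by
      gcongr; exact norm_diagMul_le _ _
    have := young ‖b'‖ (‖r - fun _ => ρ₀‖ * (σ i * ‖y‖))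
    linarith
  have h2 : 2 * inner ℝ (diagMul r (∑ j, A j (w j))) (A i y) ≤
      1 / α * ∑ j, σ j ^ 2 * ‖w j‖ ^ 2 + N * (α * (‖r‖ * (σ i * ‖y‖)) ^ 2) := by
    have h := real_inner_le_norm (diagMul r (∑ j, A j (w j))) (A i y)
    have hs : ‖∑ j, A j (w j)‖ ≤ ∑ j, σ j * ‖w j‖ :=
      (norm_sum_le _ _).trans (Finset.sum_le_sum fun j _ => hA j ▸ (A j).le_opNorm (w j))
    have h' : ‖diagMul r (∑ j, A j (w j))‖ * ‖A i y‖ ≤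
        (‖r‖ * ∑ j, σ j * ‖w j‖) * (σ i * ‖y‖) := by
      have hs0 := (norm_nonneg _).trans hs
      gcongr; exact (norm_diagMul_le _ _).trans (by gcongr)
    have h3 : 2 * ((‖r‖ * ∑ j, σ j * ‖w j‖) * (σ i * ‖y‖)) =
        ∑ j, 2 * ((σ j * ‖w j‖) * (‖r‖ * (σ i * ‖y‖))) := by
      rw [← Finset.mul_sum, ← Finset.sum_mul]; ring
    have h4 : ∑ j, 2 * ((σ j * ‖w j‖) * (‖r‖ * (σ i * ‖y‖))) ≤
        ∑ j, (1 / α * (σ j ^ 2 * ‖w j‖ ^ 2) + α * (‖r‖ * (σ i * ‖y‖)) ^ 2) :=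
      Finset.sum_le_sum fun j _ => by
        have := young (σ j * ‖w j‖) (‖r‖ * (σ i * ‖y‖))
        rwa [mul_pow (σ j)] at this
    rw [← h3, Finset.sum_add_distrib, ← Finset.mul_sum, Finset.sum_const, Finset.card_univ,
      Fintype.card_fin, nsmul_eq_mul] at h4
    linarith
  -- Only the part `ρ₀ b'`, common to all agents, sums up to `‖b'‖²`. The deviation of the penalty
  -- from `ρ₀ I` and the change of the constraint residual during the round are paid for by Young's
  -- inequality.
  have hbb : diagMul r b = ρ₀ • b' + diagMul (r - fun _ => ρ₀) b'
      - diagMul r (∑ j, A j (w j)) := by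
    rw [diagMul_sub_const, hb, diagMul_add]; abel
  rw [hbb, inner_sub_left, inner_add_left, real_inner_smul_left]
  linarith

/-- Decrease of the `G`-norm in a round without noise; `y`, `y'` and `l`, `l'` are the primal and
dual errors before and after the round. -/
theorem exact_descent (hα : 0 < α) (hζ : 0 < ζ) (hA : ∀ i, ‖A i‖ = σ i)
    (r : Fin N → Fin q → ℝ)
    (hcurv : ∀ i, α * (N * ‖r i‖ ^ 2 * σ i ^ 2 + ‖r i - fun _ => ρ₀‖ ^ 2 * σ i ^ 2) < m i)
    (hζρ : ζ < 2 * ρ₀ - N / α) (y y' g : Fin N → Vec d) (l l' : Vec q)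
    (hy : ∀ i, D i • (y' i - y i) = ContinuousLinearMap.adjoint (A i)
      (l - diagMul (r i) (∑ j, A j (y j))) - g i)
    (hl : l' = l - ζ • ∑ j, A j (y' j))
    (hg : ∀ i, m i * ‖y' i‖ ^ 2 + m i * ‖y i‖ ^ 2 - L i * ‖y' i - y i‖ ^ 2 ≤
      2 * inner ℝ (g i) (y' i)) :
    ∑ i, ((D i - N * σ i ^ 2 / α - L i) * ‖y' i - y i‖ ^ 2 + m i * ‖y i‖ ^ 2) ≤
      gNormSq D ζ (y, l) - gNormSq D ζ (y', l') := by
  set b : Vec q := ∑ j, A j (y j) with hb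
  set b' : Vec q := ∑ j, A j (y' j) with hb'
  have hbb : b' = b + ∑ j, A j (y' j - y j) := by
    simp [hb, hb', Finset.sum_sub_distrib]
  set W := ∑ j, σ j ^ 2 * ‖y' j - y j‖ ^ 2 with hW
  set Q : Fin N → ℝ := fun i =>
    α * (N * ‖r i‖ ^ 2 * σ i ^ 2 + ‖r i - fun _ => ρ₀‖ ^ 2 * σ i ^ 2) with hQ
  have hpen := fun i => penalty_lower (ρ₀ := ρ₀) hα hA (r i) i (fun j => y' j - y j) (y' i) b b' hbb
  have hterm : ∀ i, D i * ‖y i‖ ^ 2 - D i * ‖y' i‖ ^ 2 =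
      D i * ‖y' i - y i‖ ^ 2 - 2 * inner ℝ l (A i (y' i))
        + 2 * inner ℝ (diagMul (r i) b) (A i (y' i)) + 2 * inner ℝ (g i) (y' i) := by
    intro i
    have h1 : inner ℝ (D i • (y' i - y i)) (y' i) =
        inner ℝ l (A i (y' i)) - inner ℝ (diagMul (r i) b) (A i (y' i))
          - inner ℝ (g i) (y' i) := by
      rw [hy i, inner_sub_left, ContinuousLinearMap.adjoint_inner_left, inner_sub_left]
    have h2 : ‖y i‖ ^ 2 = ‖y' i‖ ^ 2 - 2 * inner ℝ (y' i - y i) (y' i) + ‖y' i - y i‖ ^ 2 := by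
      have := norm_sub_sq_real (y' i) (y' i - y i)
      rw [sub_sub_cancel] at this
      rw [this, real_inner_comm]
    rw [real_inner_smul_left] at h1
    rw [h2]
    linear_combination (-2) * h1
  have hdual : ζ⁻¹ * ‖l‖ ^ 2 - ζ⁻¹ * ‖l'‖ ^ 2 = 2 * inner ℝ l b' - ζ * ‖b'‖ ^ 2 := by
    rw [hl, norm_sub_sq_real, real_inner_smul_right, norm_smul, Real.norm_of_nonneg hζ.le]
    field_simp
    ring
  have hsum : ∑ i, inner ℝ l (A i (y' i)) = inner ℝ l b' := by rw [hb', inner_sum]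
  have hsum' : ∑ i, inner ℝ b' (A i (y' i)) = ‖b'‖ ^ 2 := by
    rw [← inner_sum, ← hb', real_inner_self_eq_norm_sq]
  have hlow : ∀ i, (D i - L i) * ‖y' i - y i‖ ^ 2 + m i * ‖y i‖ ^ 2
      - 2 * inner ℝ l (A i (y' i)) + 2 * ρ₀ * inner ℝ b' (A i (y' i))
      - 1 / α * ‖b'‖ ^ 2 - 1 / α * W ≤ D i * ‖y i‖ ^ 2 - D i * ‖y' i‖ ^ 2 := by
    intro i
    rw [hterm i]
    have h1 := hpen i
    have h2 := hg i
    -- Of the two curvature terms in `hg`, the one at `y'` pays for the penalty loss; the one at `y`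
    -- survives as decrease.
    have h3 : Q i * ‖y' i‖ ^ 2 ≤ m i * ‖y' i‖ ^ 2 := by
      gcongr; exact (hcurv i).le
    linarith
  have hS := Finset.sum_le_sum fun i (_ : i ∈ Finset.univ) => hlow i
  simp only [Finset.sum_add_distrib, Finset.sum_sub_distrib, ← Finset.mul_sum, hsum, hsum',
    Finset.sum_const, Finset.card_univ, Fintype.card_fin, nsmul_eq_mul] at hS
  have hgoal : ∑ i, ((D i - N * σ i ^ 2 / α - L i) * ‖y' i - y i‖ ^ 2 + m i * ‖y i‖ ^ 2) =
      ∑ i, (D i - L i) * ‖y' i - y i‖ ^ 2 + ∑ i, m i * ‖y i‖ ^ 2 - N / α * W := by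
    rw [hW, Finset.mul_sum, ← Finset.sum_add_distrib, ← Finset.sum_sub_distrib]
    refine Finset.sum_congr rfl fun i _ => ?_
    ring
  rw [hgoal]
  unfold gNormSq
  dsimp only
  -- The inner products of `l` and `b'` cancel between the primal sum and `hdual`. Each agent costs
  -- `‖b'‖² / α`, which leaves this coefficient, nonnegative by the choice of `ζ`.
  have hpos : 0 ≤ (2 * ρ₀ - N / α - ζ) * ‖b'‖ ^ 2 :=
    mul_nonneg (by linarith) (sq_nonneg _)
  have e1 : 1 / α * (N * ‖b'‖ ^ 2) = N / α * ‖b'‖ ^ 2 := by ring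
  have e2 : 1 / α * (N * W) = N / α * W := by ring
  rw [e1, e2] at hS
  linarith

/-- The `G`-norm after a round without noise, bounded by the primal error before the round and the
primal increment. -/
theorem exact_upper (hα : 0 < α) (hN : 1 ≤ N) (hζ : 0 < ζ) {τ S : ℝ} (hτ : 0 < τ)
    (hDp : ∀ i, 0 < D i) (hA : ∀ i, ‖A i‖ = σ i)
    (hDS : ∀ i, D i ≤ S) (hDS2 : ∀ i, D i ^ 2 ≤ S) (hmS : ∀ i, m i / α ≤ S)
    (hLS : ∀ i, L i ^ 2 ≤ S) (hσS : ∀ i, σ i ^ 2 ≤ S)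
    (r : Fin N → Fin q → ℝ)
    (hcurv : ∀ i, α * (N * ‖r i‖ ^ 2 * σ i ^ 2 + ‖r i - fun _ => ρ₀‖ ^ 2 * σ i ^ 2) < m i)
    (y y' g : Fin N → Vec d) (l l' : Vec q)
    (hy : ∀ i, D i • (y' i - y i) = ContinuousLinearMap.adjoint (A i)
      (l - diagMul (r i) (∑ j, A j (y j))) - g i)
    (hl : l' = l - ζ • ∑ j, A j (y' j)) (hg : ∀ i, ‖g i‖ ≤ L i * ‖y i‖)
    (hτl : τ * ‖l'‖ ^ 2 ≤ ∑ i, ‖ContinuousLinearMap.adjoint (A i) l'‖ ^ 2) :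
    gNormSq D ζ (y', l') ≤
      (2 * S + ζ⁻¹ * (4 * (2 * S + N ^ 2 * S ^ 2 + 2 * ζ ^ 2 * N ^ 2 * S ^ 2) / τ)) *
        ∑ i, (‖y' i - y i‖ ^ 2 + ‖y i‖ ^ 2) := by
  set b : Vec q := ∑ j, A j (y j) with hb
  set b' : Vec q := ∑ j, A j (y' j) with hb'
  set Q := ∑ i, (‖y' i - y i‖ ^ 2 + ‖y i‖ ^ 2) with hQ
  have hS0 : 0 ≤ S := (hDp ⟨0, hN⟩).le.trans (hDS _)
  have hQw : ∑ i, ‖y' i - y i‖ ^ 2 ≤ Q := Finset.sum_le_sum fun i _ => by nlinarith [norm_nonneg (y i)]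
  have hQy : ∑ i, ‖y i‖ ^ 2 ≤ Q := Finset.sum_le_sum fun i _ => by
    nlinarith [norm_nonneg (y' i - y i)]
  have hQ0 : 0 ≤ Q := (Finset.sum_nonneg fun i _ => sq_nonneg ‖y i‖).trans hQy
  have hQy' : ∑ i, ‖y' i‖ ^ 2 ≤ 2 * Q := by
    rw [hQ, Finset.mul_sum]
    refine Finset.sum_le_sum fun i _ => ?_
    have := norm_add_sq_le one_pos (y' i - y i) (y i)
    rw [sub_add_cancel] at this
    linarith
  have hbound : ∀ z : Fin N → Vec d, ‖∑ j, A j (z j)‖ ^ 2 ≤ N * (S * ∑ j, ‖z j‖ ^ 2) := by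
    intro z
    refine (norm_sum_sq_le _).trans ?_
    rw [Finset.mul_sum (a := S)]
    gcongr with j
    calc ‖A j (z j)‖ ^ 2 ≤ (σ j * ‖z j‖) ^ 2 := by
          gcongr; exact hA j ▸ (A j).le_opNorm _
      _ = σ j ^ 2 * ‖z j‖ ^ 2 := by ring
      _ ≤ _ := by gcongr; exact hσS j
  have hbQ : ‖b‖ ^ 2 ≤ N * (S * Q) := (hbound y).trans (by gcongr)
  have hb'Q : ‖b'‖ ^ 2 ≤ N * (S * (2 * Q)) := (hbound y').trans (by gcongr)
  have hadj : ∀ i (v : Vec q), ‖ContinuousLinearMap.adjoint (A i) v‖ ≤ σ i * ‖v‖ := by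
    intro i v
    have := (ContinuousLinearMap.adjoint (A i)).le_opNorm v
    rwa [LinearIsometryEquiv.norm_map, hA i] at this
  -- Since `N ≥ 1`, the curvature condition alone bounds the penalty by a quantity that is free of
  -- `r`.
  have hrσ : ∀ i, (σ i * ‖r i‖) ^ 2 ≤ S := by
    intro i
    refine le_trans ?_ (hmS i)
    rw [le_div_iff₀ hα]
    have hN' : (1 : ℝ) ≤ N := by exact_mod_cast hN
    have h1 : 0 ≤ α * (‖r i - fun _ => ρ₀‖ ^ 2 * σ i ^ 2) := by positivity
    have h2 : 0 ≤ α * ((N - 1) * (‖r i‖ ^ 2 * σ i ^ 2)) :=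
      mul_nonneg hα.le (mul_nonneg (by linarith) (by positivity))
    nlinarith [hcurv i]
  have hfour : ∀ i, ‖ContinuousLinearMap.adjoint (A i) l'‖ ^ 2 ≤
      4 * (S * (‖y' i - y i‖ ^ 2 + ‖y i‖ ^ 2) + S * ‖b‖ ^ 2 + ζ ^ 2 * (S * ‖b'‖ ^ 2)) := by
    intro i
    -- The primal update solved for the dual error: it converts control of the primal errors into
    -- control of `Aᵢᵀ l'`.
    have e : ContinuousLinearMap.adjoint (A i) l' = D i • (y' i - y i) +
        ContinuousLinearMap.adjoint (A i) (diagMul (r i) b) + g i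
        - ζ • ContinuousLinearMap.adjoint (A i) b' := by
      rw [hy i, hl, map_sub, map_sub, map_smul]; abel
    have h1 : ‖ContinuousLinearMap.adjoint (A i) l'‖ ≤ D i * ‖y' i - y i‖ +
        σ i * ‖r i‖ * ‖b‖ + L i * ‖y i‖ + ζ * (σ i * ‖b'‖) := by
      rw [e]
      refine (norm_sub_le _ _).trans (add_le_add ((norm_add₃_le).trans ?_) ?_)
      · gcongr
        · rw [norm_smul, Real.norm_of_nonneg (hDp i).le]
        · refine (hadj i _).trans ?_
          rw [mul_assoc]
          gcongr
          · rw [← hA i]; positivity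
          · exact norm_diagMul_le _ _
        · exact hg i
      · rw [norm_smul, Real.norm_of_nonneg hζ.le]
        gcongr; exact hadj i b'
    have h2 : ‖ContinuousLinearMap.adjoint (A i) l'‖ ^ 2 ≤ (D i * ‖y' i - y i‖ +
        σ i * ‖r i‖ * ‖b‖ + L i * ‖y i‖ + ζ * (σ i * ‖b'‖)) ^ 2 := by gcongr
    have h3 : ∀ s t u v : ℝ, (s + t + u + v) ^ 2 ≤ 4 * (s ^ 2 + t ^ 2 + u ^ 2 + v ^ 2) := by
      intro s t u v
      nlinarith [sq_nonneg (s - t), sq_nonneg (s - u), sq_nonneg (s - v), sq_nonneg (t - u),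
        sq_nonneg (t - v), sq_nonneg (u - v)]
    refine h2.trans ((h3 _ _ _ _).trans ?_)
    have k1 := mul_le_mul_of_nonneg_right (hDS2 i) (sq_nonneg ‖y' i - y i‖)
    have k2 := mul_le_mul_of_nonneg_right (hrσ i) (sq_nonneg ‖b‖)
    have k3 := mul_le_mul_of_nonneg_right (hLS i) (sq_nonneg ‖y i‖)
    have k4 := mul_le_mul_of_nonneg_left
      (mul_le_mul_of_nonneg_right (hσS i) (sq_nonneg ‖b'‖)) (sq_nonneg ζ)
    linarith only [k1, k2, k3, k4]
  have hdual : τ * ‖l'‖ ^ 2 ≤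
      4 * (2 * S + N ^ 2 * S ^ 2 + 2 * ζ ^ 2 * N ^ 2 * S ^ 2) * Q := by
    refine hτl.trans ((Finset.sum_le_sum fun i _ => hfour i).trans ?_)
    rw [← Finset.mul_sum, Finset.sum_add_distrib, Finset.sum_add_distrib, ← Finset.mul_sum, ← hQ]
    simp only [Finset.sum_const, Finset.card_univ, Fintype.card_fin, nsmul_eq_mul]
    have k1 : N * (S * ‖b‖ ^ 2) ≤ N * (S * (N * (S * Q))) := by gcongr
    have k2 : N * (ζ ^ 2 * (S * ‖b'‖ ^ 2)) ≤ N * (ζ ^ 2 * (S * (N * (S * (2 * Q))))) := by gcongr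
    have k3 : 0 ≤ S * Q := by positivity
    calc 4 * (S * Q + N * (S * ‖b‖ ^ 2) + N * (ζ ^ 2 * (S * ‖b'‖ ^ 2)))
        ≤ 4 * (2 * (S * Q) + N * (S * (N * (S * Q))) +
          N * (ζ ^ 2 * (S * (N * (S * (2 * Q)))))) := by linarith only [k1, k2, k3]
      _ = _ := by ring
  have hprimal : ∑ i, D i * ‖y' i‖ ^ 2 ≤ S * (2 * Q) := by
    refine le_trans (Finset.sum_le_sum fun i _ =>
      mul_le_mul_of_nonneg_right (hDS i) (sq_nonneg _)) ?_
    rw [← Finset.mul_sum]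
    gcongr
  have hdual' : ‖l'‖ ^ 2 ≤
      4 * (2 * S + N ^ 2 * S ^ 2 + 2 * ζ ^ 2 * N ^ 2 * S ^ 2) / τ * Q := by
    rw [div_mul_eq_mul_div, le_div_iff₀ hτ]
    linarith
  have h := mul_le_mul_of_nonneg_left hdual' (inv_nonneg.2 hζ.le)
  unfold gNormSq
  dsimp only
  linarith only [h, hprimal]

end Exact

/-! ### Contraction of one round and convergence -/

section Contraction

variable {N d q : ℕ} {A : Fin N → Vec d →L[ℝ] Vec q} {m M D σ : Fin N → ℝ} {α ρ₀ ζ : ℝ}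
  {c : Vec q} {f : Fin N → Vec d → ℝ}

/-- The term `-Aᵢᵀ ρᵢ Aᵢ xᵢ` inside `Γᵢ` supplies exactly the summand `j = i` that the update leaves
out. A round is thus a gradient step for the full constraint residual, with step size `Dᵢ⁻¹`. -/
theorem primalStep_eq (r : Fin N → Fin q → ℝ) (n : Fin N → Vec d) (u : State N d q) (i : Fin N)
    (hD : 0 < D i) :
    primalStep A c D f r n u i = u.1 i + (D i)⁻¹ • (ContinuousLinearMap.adjoint (A i)
      (u.2 - diagMul (r i) (∑ j, A j (u.1 j) - c)) - gradient (f i) (u.1 i)) + n i := by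
  have h1 : ∑ j, A j (u.1 j) = A i (u.1 i) + ∑ j ∈ Finset.univ.erase i, A j (u.1 j) :=
    (Finset.add_sum_erase _ _ (Finset.mem_univ i)).symm
  have h2 : u.1 i = (D i)⁻¹ • (D i • u.1 i) := by rw [smul_smul, inv_mul_cancel₀ hD.ne', one_smul]
  conv_rhs => rw [h2]
  rw [primalStep, Gam, h1, ← smul_add, add_sub_assoc (A i (u.1 i)), diagMul_add]
  simp only [map_sub, map_add]
  congr 2
  rw [← h2]
  abel

/-- The multiplier moves only along constraint residuals, which lie in the range of `[A₁ ⋯ A_N]`;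
this keeps the lower bound `τ` applicable in every round. -/
theorem step_snd_mem {W : Submodule ℝ (Vec q)} (hW : ∀ i x, A i x ∈ W) {us : State N d q}
    (hc : ∑ i, A i (us.1 i) = c) (r : Fin N → Fin q → ℝ) (n : Fin N → Vec d) (u : State N d q)
    (hu : u.2 - us.2 ∈ W) : (step A c D ζ f r n u).2 - us.2 ∈ W := by
  have h : (step A c D ζ f r n u).2 - us.2 =
      (u.2 - us.2) - ζ • (∑ i, A i (primalStep A c D f r n u i) - ∑ i, A i (us.1 i)) := by
    rw [hc, sub_right_comm]; rfl
  rw [h]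
  exact W.sub_mem hu (W.smul_mem _ (W.sub_mem (W.sum_mem fun i _ => hW i _)
    (W.sum_mem fun i _ => hW i _)))

theorem mem_iSup_range (A : Fin N → Vec d →L[ℝ] Vec q) (i : Fin N) (x : Vec d) :
    A i x ∈ ⨆ i, LinearMap.range (A i : Vec d →ₗ[ℝ] Vec q) :=
  (le_iSup (fun i => LinearMap.range (A i : Vec d →ₗ[ℝ] Vec q)) i) ⟨x, rfl⟩

theorem D_pos (hα : 0 < α) (hD : ∀ i, N * σ i ^ 2 / α + √(M i) < D i) (i : Fin N) : 0 < D i :=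
  lt_of_le_of_lt (by positivity) (hD i)

/-- The decrease is at least `κ Q` and the new energy at most `C Q`, so the ratio `κ / C` is a
contraction gain. Both constants are fixed before `d`, `q`, `A`, `f` and the penalties are
introduced, which gives the uniformity of `p`. -/
theorem exists_exact_contraction (hN : 1 ≤ N) {τ : ℝ}
    (hm : ∀ i, 0 < m i) (hα : 0 < α) (hζ : 0 < ζ) (hτ : 0 < τ)
    (hD : ∀ i, N * σ i ^ 2 / α + √(M i) < D i) (hζρ : ζ < 2 * ρ₀ - N / α) :
    ∃ p : ℝ, 0 < p ∧ p ≤ 1 ∧ ∀ (d q : ℕ) (A : Fin N → Vec d →L[ℝ] Vec q), (∀ i, ‖A i‖ = σ i) →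
      (∀ v ∈ (⨆ i, LinearMap.range (A i : Vec d →ₗ[ℝ] Vec q)),
        τ * ‖v‖ ^ 2 ≤ ∑ i, ‖ContinuousLinearMap.adjoint (A i) v‖ ^ 2) →
      ∀ (c : Vec q) (f : Fin N → Vec d → ℝ), (∀ i, StronglyConvexSmooth (m i) (M i) (f i)) →
      ∀ us : State N d q, IsOptimum A c f us →
      ∀ r, Admissible m D σ α ρ₀ r → ∀ u : State N d q,
        u.2 - us.2 ∈ (⨆ i, LinearMap.range (A i : Vec d →ₗ[ℝ] Vec q)) →
        (1 + p) * gNormSq D ζ (step A c D ζ f r 0 u - us) ≤ gNormSq D ζ (u - us) := by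
  have hDp := D_pos hα hD
  have : Nonempty (Fin N) := ⟨⟨0, hN⟩⟩
  obtain ⟨κ, hκ, hκm, hκD⟩ : ∃ κ : ℝ, 0 < κ ∧ (∀ i, κ ≤ m i) ∧
      ∀ i, κ ≤ D i - N * σ i ^ 2 / α - √(M i) := by
    obtain ⟨i₀, h⟩ := Finite.exists_min fun i => min (m i) (D i - N * σ i ^ 2 / α - √(M i))
    exact ⟨_, lt_min (hm i₀) (by linarith [hD i₀]), fun i => (h i).trans (min_le_left _ _),
      fun i => (h i).trans (min_le_right _ _)⟩
  obtain ⟨S, hDS, hDS2, hmS, hLS, hσS⟩ : ∃ S : ℝ, (∀ i, D i ≤ S) ∧ (∀ i, D i ^ 2 ≤ S) ∧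
      (∀ i, m i / α ≤ S) ∧ (∀ i, √(M i) ^ 2 ≤ S) ∧ (∀ i, σ i ^ 2 ≤ S) := by
    obtain ⟨i₀, h⟩ := Finite.exists_max fun i =>
      D i + D i ^ 2 + m i / α + √(M i) ^ 2 + σ i ^ 2
    have h0 : ∀ i, 0 < D i ∧ 0 ≤ D i ^ 2 ∧ 0 < m i / α ∧ 0 ≤ √(M i) ^ 2 ∧ 0 ≤ σ i ^ 2 :=
      fun i => ⟨hDp i, sq_nonneg _, div_pos (hm i) hα, sq_nonneg _, sq_nonneg _⟩
    refine ⟨_, fun i => le_trans ?_ (h i), fun i => le_trans ?_ (h i), fun i => le_trans ?_ (h i),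
      fun i => le_trans ?_ (h i), fun i => le_trans ?_ (h i)⟩ <;>
    · obtain ⟨h1, h2, h3, h4, h5⟩ := h0 i
      linarith
  have hS : 0 < S := (hDp ⟨0, hN⟩).trans_le (hDS _)
  set C := 2 * S + ζ⁻¹ * (4 * (2 * S + N ^ 2 * S ^ 2 + 2 * ζ ^ 2 * N ^ 2 * S ^ 2) / τ) with hC
  have hCpos : 0 < C := by positivity
  -- The cap at `1` serves the later splitting between contraction and noise, where products such as
  -- `p s` must be small.
  refine ⟨min 1 (κ / C), by positivity, min_le_left _ _, ?_⟩
  intro d q A hA hτA c f hf us hus r hr u hu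
  set u' := step A c D ζ f r 0 u with hu'
  have hy : ∀ i, D i • ((u'.1 i - us.1 i) - (u.1 i - us.1 i)) =
      ContinuousLinearMap.adjoint (A i)
        ((u.2 - us.2) - diagMul (r i) (∑ j, A j (u.1 j - us.1 j)))
        - (gradient (f i) (u.1 i) - gradient (f i) (us.1 i)) := by
    intro i
    have h1 : u'.1 i = _ := primalStep_eq (c := c) (f := f) (A := A) r 0 u i (hDp i)
    rw [h1, hus.multiplier i]
    simp only [map_sub, Finset.sum_sub_distrib, hus.feasible, Pi.zero_apply, add_zero]
    rw [sub_sub_sub_cancel_right, add_sub_cancel_left, smul_smul, mul_inv_cancel₀ (hDp i).ne',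
      one_smul]
    abel
  have hl : u'.2 - us.2 = (u.2 - us.2) - ζ • ∑ j, A j (u'.1 j - us.1 j) := by
    simp only [map_sub, Finset.sum_sub_distrib, hus.feasible]
    rw [hu', step]
    dsimp only
    abel
  have hlow := exact_descent (L := fun i => √(M i)) hα hζ hA r hr.curvature hζρ
    (fun i => u.1 i - us.1 i) (fun i => u'.1 i - us.1 i)
    (fun i => gradient (f i) (u.1 i) - gradient (f i) (us.1 i)) (u.2 - us.2) (u'.2 - us.2)
    hy hl (fun i => by
      have := (hf i).three_point (us.1 i) (u.1 i) (u'.1 i)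
      simpa only [sub_sub_sub_cancel_right] using this)
  have hup := exact_upper (L := fun i => √(M i)) hα hN hζ hτ hDp hA hDS hDS2 hmS hLS hσS r
    hr.curvature (fun i => u.1 i - us.1 i) (fun i => u'.1 i - us.1 i)
    (fun i => gradient (f i) (u.1 i) - gradient (f i) (us.1 i)) (u.2 - us.2) (u'.2 - us.2)
    hy hl (fun i => (hf i).smooth _ _)
    (hτA _ (step_snd_mem (mem_iSup_range A) hus.feasible r 0 u hu))
  have hQ : κ * ∑ i, (‖(u'.1 i - us.1 i) - (u.1 i - us.1 i)‖ ^ 2 + ‖u.1 i - us.1 i‖ ^ 2) ≤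
      gNormSq D ζ (u - us) - gNormSq D ζ (u' - us) := by
    refine le_trans ?_ hlow
    rw [Finset.mul_sum]
    refine Finset.sum_le_sum fun i _ => ?_
    rw [mul_add]
    gcongr
    · exact hκD i
    · exact hκm i
  have hpp : min 1 (κ / C) * gNormSq D ζ (u' - us) ≤
      κ * ∑ i, (‖(u'.1 i - us.1 i) - (u.1 i - us.1 i)‖ ^ 2 + ‖u.1 i - us.1 i‖ ^ 2) := by
    calc min 1 (κ / C) * gNormSq D ζ (u' - us) ≤ κ / C * (C *
          ∑ i, (‖(u'.1 i - us.1 i) - (u.1 i - us.1 i)‖ ^ 2 + ‖u.1 i - us.1 i‖ ^ 2)) := by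
          refine mul_le_mul (min_le_right _ _) hup (gNormSq_nonneg hDp hζ _) (by positivity)
      _ = _ := by field_simp
  linarith

theorem step_noise (hDp : ∀ i, 0 < D i) (r : Fin N → Fin q → ℝ) (n : Fin N → Vec d)
    (u : State N d q) :
    step A c D ζ f r n u = step A c D ζ f r 0 u + (n, -(ζ • ∑ i, A i (n i))) := by
  have h : ∀ i, primalStep A c D f r n u i = primalStep A c D f r 0 u i + n i := fun i => by
    rw [primalStep_eq r n u i (hDp i), primalStep_eq r 0 u i (hDp i)]; simp
  refine Prod.ext (funext h) ?_
  simp only [step, h, map_add, Finset.sum_add_distrib, Prod.snd_add, smul_sub, smul_add]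
  abel

/-- Noise hits the multiplier too, through `ζ ∑ Aᵢ nᵢ`. The lower bound on `Dᵢ` gives `N σᵢ² ≤ α
Dᵢ`, so this costs only the extra factor `ζ α`. -/
theorem gNormSq_noise_le (hα : 0 < α) (hζ : 0 < ζ) (hA : ∀ i, ‖A i‖ = σ i)
    (hD : ∀ i, N * σ i ^ 2 / α + √(M i) < D i) (n : Fin N → Vec d) :
    gNormSq D ζ (n, -(ζ • ∑ i, A i (n i))) ≤ (1 + ζ * α) * ∑ i, D i * ‖n i‖ ^ 2 := by
  have h1 : ‖∑ i, A i (n i)‖ ^ 2 ≤ α * ∑ i, D i * ‖n i‖ ^ 2 := by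
    refine (norm_sum_sq_le _).trans ?_
    rw [Finset.mul_sum, Finset.mul_sum]
    refine Finset.sum_le_sum fun i _ => ?_
    have h2 : N * σ i ^ 2 ≤ α * D i := by
      have := hD i
      have h3 : N * σ i ^ 2 / α < D i := by linarith [Real.sqrt_nonneg (M i)]
      rw [div_lt_iff₀ hα] at h3
      linarith
    calc (N : ℝ) * ‖A i (n i)‖ ^ 2 ≤ N * (σ i * ‖n i‖) ^ 2 := by
          gcongr; exact hA i ▸ (A i).le_opNorm _
      _ = N * σ i ^ 2 * ‖n i‖ ^ 2 := by ring
      _ ≤ α * D i * ‖n i‖ ^ 2 := by gcongr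
      _ = _ := by ring
  unfold gNormSq
  dsimp only
  rw [norm_neg, norm_smul, Real.norm_of_nonneg hζ.le]
  have h4 : ζ⁻¹ * (ζ * ‖∑ i, A i (n i)‖) ^ 2 = ζ * ‖∑ i, A i (n i)‖ ^ 2 := by field_simp
  rw [h4]
  nlinarith [mul_le_mul_of_nonneg_left h1 hζ.le]

theorem rate_mem_Ioo {p θ : ℝ} (hp : 0 < p) (hθ : θ < 1) : rate p θ ∈ Set.Ioo (0 : ℝ) 1 := by
  have h : 0 < (1 - θ) * p := mul_pos (by linarith) hp
  unfold rate
  exact ⟨by positivity, by rw [div_lt_one (by linarith)]; linarith⟩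

/-- Young's inequality with weight `s / 2` spends half of the noiseless gain `s` on the noise. The
weight does not involve `θ`, so one `p` serves all `θ`. -/
theorem exists_contraction (hN : 1 ≤ N) {τ : ℝ}
    (hm : ∀ i, 0 < m i) (hα : 0 < α) (hζ : 0 < ζ) (hτ : 0 < τ)
    (hD : ∀ i, N * σ i ^ 2 / α + √(M i) < D i) (hζρ : ζ < 2 * ρ₀ - N / α) :
    ∃ p : ℝ, 0 < p ∧ ∀ θ : ℝ, 0 < θ → θ < 1 →
      ∀ (d q : ℕ) (A : Fin N → Vec d →L[ℝ] Vec q), (∀ i, ‖A i‖ = σ i) →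
      (∀ v ∈ (⨆ i, LinearMap.range (A i : Vec d →ₗ[ℝ] Vec q)),
        τ * ‖v‖ ^ 2 ≤ ∑ i, ‖ContinuousLinearMap.adjoint (A i) v‖ ^ 2) →
      ∀ (c : Vec q) (f : Fin N → Vec d → ℝ), (∀ i, StronglyConvexSmooth (m i) (M i) (f i)) →
      ∀ us : State N d q, IsOptimum A c f us →
      ∀ r, Admissible m D σ α ρ₀ r → ∀ (n : Fin N → Vec d) (u : State N d q),
        u.2 - us.2 ∈ (⨆ i, LinearMap.range (A i : Vec d →ₗ[ℝ] Vec q)) →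
        gNormSq D ζ (step A c D ζ f r n u - us) ≤
          rate p θ * (gNormSq D ζ (u - us) + ∑ i, noiseCoeff A D ζ p θ i * ‖n i‖ ^ 2) := by
  obtain ⟨s, hs, hs1, H⟩ := exists_exact_contraction hN hm hα hζ hτ hD hζρ
  have hDp := D_pos hα hD
  set E := 1 + ζ * α with hE
  have hE1 : 1 ≤ E := by rw [hE]; nlinarith [mul_pos hζ hα]
  have hE0 : 0 < E := by linarith
  -- Small enough for two requirements, given `s ≤ 1`: the contraction needs `(1 + p) (1 + s / 2) ≤
  -- 1 + s`, and the noise needs `(1 + p) (1 + 2 / s) E ≤ 1 / (θ p)`.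
  set p := s / (8 * E) with hp
  have hp0 : 0 < p := by positivity
  have hpE : p * E = s / 8 := by rw [hp]; field_simp
  have hp8 : p ≤ s / 8 := by nlinarith
  refine ⟨p, hp0, ?_⟩
  intro θ hθ hθ1 d q A hA hτA c f hf us hus r hr n u hu
  have h1 := H d q A hA hτA c f hf us hus r hr u hu
  have h2 : gNormSq D ζ (step A c D ζ f r n u - us) ≤
      (1 + s / 2) * gNormSq D ζ (step A c D ζ f r 0 u - us) +
        (1 + 1 / (s / 2)) * (E * ∑ i, D i * ‖n i‖ ^ 2) := by
    rw [step_noise hDp, add_sub_right_comm]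
    refine (gNormSq_add_le hDp hζ (half_pos hs) _ _).trans ?_
    gcongr
    exact gNormSq_noise_le hα hζ hA hD n
  have hT : 0 ≤ ∑ i, D i * ‖n i‖ ^ 2 :=
    Finset.sum_nonneg fun i _ => mul_nonneg (hDp i).le (sq_nonneg _)
  -- The summand `Dᵢ / (θ p)` of the coefficient already suffices. The one with `sigmaMin` only has
  -- to be nonnegative, which also holds when it is a division by zero.
  have h3 : 1 / (θ * p) * ∑ i, D i * ‖n i‖ ^ 2 ≤ ∑ i, noiseCoeff A D ζ p θ i * ‖n i‖ ^ 2 := by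
    rw [Finset.mul_sum]
    refine Finset.sum_le_sum fun i _ => ?_
    rw [← mul_assoc]
    gcongr
    have : 0 ≤ 6 * p * D i ^ 2 / (ζ * N * sigmaMin (A i) ^ 2) := by positivity
    have e : 1 / (θ * p) * D i = D i / (θ * p) := by ring
    rw [e, noiseCoeff]
    linarith
  have hp1 : 1 + (1 - θ) * p ≤ 1 + p := by nlinarith
  have hpos : 0 < 1 + (1 - θ) * p := by nlinarith
  have h4 : (1 + p) * (1 + s / 2) ≤ 1 + s := by nlinarith
  have h5 : (1 + p) * ((1 + 1 / (s / 2)) * E) ≤ 1 / (θ * p) := by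
    rw [le_div_iff₀ (by positivity)]
    have e : (1 + p) * ((1 + 1 / (s / 2)) * E) * (θ * p) = (1 + p) * θ * ((s + 2) / 8) := by
      have : (1 + p) * ((1 + 1 / (s / 2)) * E) * (θ * p) =
        (1 + p) * θ * (1 + 1 / (s / 2)) * (p * E) := by ring
      rw [this, hpE]
      field_simp
    rw [e]
    have : (1 + p) * θ ≤ 9 / 8 := by nlinarith
    nlinarith
  have hg := gNormSq_nonneg hDp hζ (step A c D ζ f r 0 u - us)
  have hg' := gNormSq_nonneg hDp hζ (step A c D ζ f r n u - us)
  rw [rate, one_div, inv_mul_eq_div, le_div_iff₀ hpos]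
  calc gNormSq D ζ (step A c D ζ f r n u - us) * (1 + (1 - θ) * p)
      ≤ gNormSq D ζ (step A c D ζ f r n u - us) * (1 + p) := by gcongr
    _ ≤ ((1 + s / 2) * gNormSq D ζ (step A c D ζ f r 0 u - us) +
        (1 + 1 / (s / 2)) * (E * ∑ i, D i * ‖n i‖ ^ 2)) * (1 + p) := by gcongr
    _ = (1 + p) * (1 + s / 2) * gNormSq D ζ (step A c D ζ f r 0 u - us) +
        (1 + p) * ((1 + 1 / (s / 2)) * E) * ∑ i, D i * ‖n i‖ ^ 2 := by ring
    _ ≤ (1 + s) * gNormSq D ζ (step A c D ζ f r 0 u - us) +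
        1 / (θ * p) * ∑ i, D i * ‖n i‖ ^ 2 := by gcongr
    _ ≤ _ := add_le_add h1 h3

/-! ### Unrolling the recursion over the rounds. -/

theorem sum_Icc_one_eq_sum_range (a : ℝ) (b : ℕ → ℝ) (k : ℕ) :
    ∑ j ∈ Finset.Icc 1 k, a ^ j * b (k + 1 - j) = ∑ j ∈ Finset.range k, a ^ (j + 1) * b (k - j) := by
  rw [← Finset.Ico_add_one_right_eq_Icc, Finset.sum_Ico_eq_sum_range]
  refine Finset.sum_congr rfl fun j _ => ?_
  rw [add_comm 1 j, Nat.add_sub_add_right]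

theorem residual_succ (ζ p θ : ℝ) (noise : ℕ → Fin N → Vec d) (k : ℕ) :
    residual A D ζ p θ noise (k + 1) = rate p θ * (residual A D ζ p θ noise k +
      ∑ i, noiseCoeff A D ζ p θ i * ‖noise (k + 1) i‖ ^ 2) := by
  unfold residual
  rw [← Finset.sum_add_distrib, Finset.mul_sum]
  refine Finset.sum_congr rfl fun i _ => ?_
  rw [sum_Icc_one_eq_sum_range (rate p θ) (fun k => ‖noise k i‖ ^ 2),
    sum_Icc_one_eq_sum_range (rate p θ) (fun k => ‖noise k i‖ ^ 2), Finset.sum_range_succ']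
  have h : ∑ j ∈ Finset.range k, rate p θ ^ (j + 1 + 1) * ‖noise (k + 1 - (j + 1)) i‖ ^ 2 =
      rate p θ * ∑ j ∈ Finset.range k, rate p θ ^ (j + 1) * ‖noise (k - j) i‖ ^ 2 := by
    rw [Finset.mul_sum]
    refine Finset.sum_congr rfl fun j _ => ?_
    rw [Nat.add_sub_add_right]
    ring
  rw [h, Nat.sub_zero, zero_add, pow_one]
  ring

/-- Dominated convergence for series: for fixed `j` the term tends to `0` with `b (k - j)`, and `C a
^ (j + 1)` is a summable majorant. -/
theorem tendsto_geom_convolution {a : ℝ} (ha0 : 0 ≤ a) (ha1 : a < 1) {b : ℕ → ℝ}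
    (hb : Tendsto b atTop (𝓝 0)) :
    Tendsto (fun k => ∑ j ∈ Finset.range k, a ^ (j + 1) * b (k - j)) atTop (𝓝 0) := by
  obtain ⟨C, hC⟩ := hb.norm.bddAbove_range
  have hC' : ∀ k, ‖b k‖ ≤ C := fun k => hC ⟨k, rfl⟩
  have h := tendsto_tsum_of_dominated_convergence (𝓕 := atTop)
    (f := fun (k j : ℕ) => if j < k then a ^ (j + 1) * b (k - j) else 0) (g := fun _ => (0 : ℝ))
    (bound := fun j => a ^ (j + 1) * C)
    (((summable_nat_add_iff 1).2 (summable_geometric_of_lt_one ha0 ha1)).mul_right C)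
    (fun j => by
      have h1 : Tendsto (fun k => a ^ (j + 1) * b (k - j)) atTop (𝓝 (a ^ (j + 1) * 0)) :=
        (hb.comp (tendsto_sub_atTop_nat j)).const_mul _
      rw [mul_zero] at h1
      refine h1.congr' ?_
      filter_upwards [eventually_gt_atTop j] with k hk
      rw [if_pos hk])
    (Eventually.of_forall fun k j => by
      split_ifs
      · rw [norm_mul, Real.norm_of_nonneg (pow_nonneg ha0 _)]
        gcongr
        exact hC' _
      · rw [norm_zero]
        exact mul_nonneg (pow_nonneg ha0 _) ((norm_nonneg _).trans (hC' 0)))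
  rw [tsum_zero] at h
  refine h.congr fun k => ?_
  rw [tsum_eq_sum (s := Finset.range k) (fun j hj => if_neg (by simpa using hj))]
  exact Finset.sum_congr rfl fun j hj => if_pos (Finset.mem_range.1 hj)

theorem tendsto_residual {p θ : ℝ} (hp : 0 < p) (hθ : θ < 1) (ζ : ℝ) {noise : ℕ → Fin N → Vec d}
    (h : ∀ i, Tendsto (fun k => noise k i) atTop (𝓝 0)) :
    Tendsto (fun k => residual A D ζ p θ noise k) atTop (𝓝 0) := by
  have ha := rate_mem_Ioo hp hθ
  have h1 := tendsto_finsetSum Finset.univ fun i (_ : i ∈ Finset.univ) =>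
    (tendsto_geom_convolution ha.1.le ha.2 (b := fun k => ‖noise k i‖ ^ 2)
      (by simpa using (h i).norm.pow 2)).const_mul (noiseCoeff A D ζ p θ i)
  simp only [mul_zero, Finset.sum_const_zero] at h1
  refine h1.congr fun k => Finset.sum_congr rfl fun i _ => ?_
  rw [sum_Icc_one_eq_sum_range (rate p θ) (fun k => ‖noise k i‖ ^ 2)]

theorem iter_le {p θ : ℝ} (hp : 0 < p) (hθ : θ < 1) {us : State N d q}
    (hc : ∑ i, A i (us.1 i) = c) {ρ : ℕ → Fin N → Fin q → ℝ} {noise : ℕ → Fin N → Vec d}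
    (hstep : ∀ k (u : State N d q),
      u.2 - us.2 ∈ (⨆ i, LinearMap.range (A i : Vec d →ₗ[ℝ] Vec q)) →
        gNormSq D ζ (step A c D ζ f (ρ (k + 1)) (noise (k + 1)) u - us) ≤ rate p θ *
          (gNormSq D ζ (u - us) + ∑ i, noiseCoeff A D ζ p θ i * ‖noise (k + 1) i‖ ^ 2))
    {u0 : State N d q} (hu0 : u0.2 - us.2 ∈ (⨆ i, LinearMap.range (A i : Vec d →ₗ[ℝ] Vec q)))
    (k : ℕ) : gNormSq D ζ (iter A c D ζ f ρ noise u0 k - us) ≤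
      rate p θ ^ k * gNormSq D ζ (u0 - us) + residual A D ζ p θ noise k := by
  have hmem : ∀ k, (iter A c D ζ f ρ noise u0 k).2 - us.2 ∈
      (⨆ i, LinearMap.range (A i : Vec d →ₗ[ℝ] Vec q)) := by
    intro k
    induction k with
    | zero => exact hu0
    | succ k ih => exact step_snd_mem (mem_iSup_range A) hc _ _ _ ih
  induction k with
  | zero => simp [iter, residual]
  | succ k ih =>
    rw [residual_succ, iter]
    refine (hstep k _ (hmem k)).trans ?_
    have := mul_le_mul_of_nonneg_left ih (rate_mem_Ioo hp hθ).1.le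
    rw [pow_succ]
    linarith

end Contraction

/-! ### Moment generating function of a bounded privacy loss -/

theorem sinh_le_mul_cosh {x : ℝ} (hx : 0 ≤ x) : Real.sinh x ≤ x * Real.cosh x := by
  have hd : ∀ y, HasDerivAt (fun y => y * Real.cosh y - Real.sinh y) (y * Real.sinh y) y := by
    intro y
    refine (((hasDerivAt_id y).mul (Real.hasDerivAt_cosh y)).sub
      (Real.hasDerivAt_sinh y)).congr_deriv ?_
    simp
  have hmono : MonotoneOn (fun y => y * Real.cosh y - Real.sinh y) (Set.Ici 0) := by
    refine monotoneOn_of_deriv_nonneg (convex_Ici 0)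
      (fun y _ => (hd y).continuousAt.continuousWithinAt)
      (fun y _ => (hd y).differentiableAt.differentiableWithinAt) fun y hy => ?_
    rw [interior_Ici] at hy
    rw [(hd y).deriv]
    exact mul_nonneg (le_of_lt hy) (Real.sinh_nonneg_iff.2 (le_of_lt hy))
  have := hmono (Set.mem_Ici.2 le_rfl) (Set.mem_Ici.2 hx) hx
  simp at this
  linarith

/-- By `sinh_le_mul_cosh`, the function `cosh y * exp (-y² / 2)` is decreasing on `[0, ∞)`. -/
theorem cosh_div_cosh_le {a b : ℝ} (ha : 0 ≤ a) (hab : a ≤ b) :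
    Real.cosh b / Real.cosh a ≤ Real.exp ((b ^ 2 - a ^ 2) / 2) := by
  have hd : ∀ y, HasDerivAt (fun y => Real.cosh y * Real.exp (-(y ^ 2 / 2)))
      ((Real.sinh y - y * Real.cosh y) * Real.exp (-(y ^ 2 / 2))) y := by
    intro y
    have h1 : HasDerivAt (fun y : ℝ => -(y ^ 2 / 2)) (-y) y := by
      refine ((((hasDerivAt_id y).pow 2).div_const 2).neg).congr_deriv ?_
      simp
    refine ((Real.hasDerivAt_cosh y).mul h1.exp).congr_deriv ?_
    ring
  have hanti : AntitoneOn (fun y => Real.cosh y * Real.exp (-(y ^ 2 / 2))) (Set.Ici 0) := by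
    refine antitoneOn_of_deriv_nonpos (convex_Ici 0)
      (fun y _ => (hd y).continuousAt.continuousWithinAt)
      (fun y _ => (hd y).differentiableAt.differentiableWithinAt) fun y hy => ?_
    rw [interior_Ici] at hy
    rw [(hd y).deriv]
    exact mul_nonpos_of_nonpos_of_nonneg (sub_nonpos.2 (sinh_le_mul_cosh (le_of_lt hy)))
      (Real.exp_pos _).le
  have h := hanti (Set.mem_Ici.2 ha) (Set.mem_Ici.2 (ha.trans hab)) hab
  dsimp only at h
  rw [div_le_iff₀ (Real.cosh_pos a)]
  have e : Real.exp ((b ^ 2 - a ^ 2) / 2) = Real.exp (-(a ^ 2 / 2)) * Real.exp (b ^ 2 / 2) := by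
    rw [← Real.exp_add]; congr 1; ring
  calc Real.cosh b = Real.cosh b * Real.exp (-(b ^ 2 / 2)) * Real.exp (b ^ 2 / 2) := by
        rw [mul_assoc, ← Real.exp_add]; simp
    _ ≤ Real.cosh a * Real.exp (-(a ^ 2 / 2)) * Real.exp (b ^ 2 / 2) := by gcongr
    _ = _ := by rw [e]; ring

/-- The left side is the chord of `exp_mul_le_chord` with `exp (-l)` replaced by its mean `1`, that
is, the moment generating function of the extremal loss with values `±c`. -/
theorem chord_integral_eq {c t : ℝ} (hc : 0 < c) :
    ((Real.exp c - 1) * Real.exp (t * c) + (1 - Real.exp (-c)) * Real.exp (-(t * c))) /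
      (Real.exp c - Real.exp (-c)) = Real.cosh ((t + 1 / 2) * c) / Real.cosh (c / 2) := by
  have h1 : Real.exp c - Real.exp (-c) ≠ 0 :=
    (sub_pos.2 (Real.exp_lt_exp.2 (by linarith))).ne'
  rw [div_eq_div_iff h1 (Real.cosh_pos _).ne', Real.cosh_eq, Real.cosh_eq]
  have e1 : Real.exp c = Real.exp (c / 2) ^ 2 := by rw [← Real.exp_nat_mul]; congr 1; ring
  have e2 : Real.exp ((t + 1 / 2) * c) = Real.exp (t * c) * Real.exp (c / 2) := by
    rw [← Real.exp_add]; congr 1; ring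
  rw [Real.exp_neg c, Real.exp_neg (t * c), Real.exp_neg ((t + 1 / 2) * c), Real.exp_neg (c / 2),
    e2, e1]
  have := (Real.exp_pos (c / 2)).ne'
  have := (Real.exp_pos (t * c)).ne'
  field_simp
  ring

/-- As a function of `x = exp (-l)` the left side is `x ^ (-t)`, which is convex and so lies below
its chord over `[exp (-c), exp c]`. The bound is affine in `exp (-l)`, the one quantity whose
integral is known. -/
theorem exp_mul_le_chord {c t l : ℝ} (hc : 0 < c) (ht : 0 ≤ t) (hl : |l| ≤ c) :
    Real.exp (t * l) ≤ ((Real.exp c - Real.exp (-l)) * Real.exp (t * c) +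
      (Real.exp (-l) - Real.exp (-c)) * Real.exp (-(t * c))) / (Real.exp c - Real.exp (-c)) := by
  obtain ⟨hl1, hl2⟩ := abs_le.1 hl
  have hD : 0 < Real.exp c - Real.exp (-c) := sub_pos.2 (Real.exp_lt_exp.2 (by linarith))
  set w := (Real.exp c - Real.exp (-l)) / (Real.exp c - Real.exp (-c)) with hw
  set v := (Real.exp (-l) - Real.exp (-c)) / (Real.exp c - Real.exp (-c)) with hv
  have hw0 : 0 ≤ w := div_nonneg (sub_nonneg.2 (Real.exp_le_exp.2 (by linarith))) hD.le
  have hv0 : 0 ≤ v := div_nonneg (sub_nonneg.2 (Real.exp_le_exp.2 (by linarith))) hD.le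
  have hwv : w + v = 1 := by rw [hw, hv, ← add_div, div_eq_one_iff_eq hD.ne']; ring
  have e : w * Real.exp (-c) + v * Real.exp c = Real.exp (-l) := by
    rw [hw, hv]; field_simp; ring
  -- Concavity of `log` gives `l ≤ (w - v) c`; convexity of `exp` then handles the combination of `t
  -- c` and `-(t c)`.
  have hlog := strictConcaveOn_log_Ioi.concaveOn.2 (Set.mem_Ioi.2 (Real.exp_pos (-c)))
    (Set.mem_Ioi.2 (Real.exp_pos c)) hw0 hv0 hwv
  simp only [smul_eq_mul, e, Real.log_exp] at hlog
  have hexp := convexOn_exp.2 (Set.mem_univ (t * c)) (Set.mem_univ (-(t * c))) hw0 hv0 hwv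
  simp only [smul_eq_mul] at hexp
  rw [add_div, mul_div_right_comm, mul_div_right_comm]
  refine le_trans (Real.exp_le_exp.2 ?_) hexp
  nlinarith

theorem integral_exp_mul_loss_le {Y : Type*} [MeasurableSpace Y] {ν : Measure Y}
    [IsProbabilityMeasure ν] {l : Y → ℝ} (hl : Measurable l) {c t : ℝ} (hc : 0 < c) (ht : 0 ≤ t)
    (hlc : ∀ y, |l y| ≤ c) (hmass : ∫⁻ y, ENNReal.ofReal (Real.exp (-l y)) ∂ν = 1) :
    ∫⁻ y, ENNReal.ofReal (Real.exp (t * l y)) ∂ν ≤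
      ENNReal.ofReal (Real.exp (t * (t + 1) * c ^ 2 / 2)) := by
  have hint : ∀ s : ℝ, Integrable (fun y => Real.exp (s * l y)) ν := fun s =>
    Integrable.of_bound (by fun_prop) (Real.exp (|s| * c)) (ae_of_all _ fun y => by
      rw [Real.norm_of_nonneg (Real.exp_pos _).le, Real.exp_le_exp]
      calc s * l y ≤ |s * l y| := le_abs_self _
        _ = |s| * |l y| := abs_mul _ _
        _ ≤ _ := by gcongr; exact hlc y)
  have hint1 : Integrable (fun y => Real.exp (-l y)) ν := by simpa using hint (-1)
  have hmass' : ∫ y, Real.exp (-l y) ∂ν = 1 := by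
    rw [integral_eq_lintegral_of_nonneg_ae (ae_of_all _ fun y => (Real.exp_pos _).le)
      hint1.aestronglyMeasurable, hmass]
    rfl
  rw [← ofReal_integral_eq_lintegral_ofReal (hint t) (ae_of_all _ fun y => (Real.exp_pos _).le)]
  refine ENNReal.ofReal_le_ofReal ?_
  have h1 : ∫ y, Real.exp (t * l y) ∂ν ≤
      ∫ y, ((Real.exp c - Real.exp (-l y)) * Real.exp (t * c) +
        (Real.exp (-l y) - Real.exp (-c)) * Real.exp (-(t * c))) /
          (Real.exp c - Real.exp (-c)) ∂ν :=
    integral_mono (hint t)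
      (((((integrable_const _).sub hint1).mul_const _).add
        ((hint1.sub (integrable_const _)).mul_const _)).div_const _)
      fun y => exp_mul_le_chord hc ht (hlc y)
  have h2 : Integrable (fun y => (Real.exp c - Real.exp (-l y)) * Real.exp (t * c)) ν :=
    ((integrable_const _).sub hint1).mul_const _
  have h3 : Integrable (fun y => (Real.exp (-l y) - Real.exp (-c)) * Real.exp (-(t * c))) ν :=
    (hint1.sub (integrable_const _)).mul_const _
  rw [integral_div, integral_add h2 h3, integral_mul_const, integral_mul_const,
    integral_sub (integrable_const _) hint1, integral_sub hint1 (integrable_const _), hmass'] at h1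
  simp only [integral_const, probReal_univ, one_smul] at h1
  rw [chord_integral_eq hc] at h1
  -- The exponent is `((t + 1/2)² - 1/4) c² / 2 = t (t + 1) c² / 2`.
  refine h1.trans ((cosh_div_cosh_le (by positivity) (by nlinarith)).trans_eq ?_)
  congr 1
  ring

/-! ### Shifted Laplace noise -/

theorem measurable_laplaceDensity (β : ℝ) :
    Measurable fun y : ℝ => ENNReal.ofReal (β / 2 * Real.exp (-(β * |y|))) := by
  fun_prop

/-- The weight turns the density at `y` into the density at `y + s`; what remains is translation
invariance of Lebesgue measure. -/
theorem lintegral_laplace_shift {β : ℝ} (hβ : 0 < β) (s : ℝ) {F : ℝ → ℝ≥0∞} (hF : Measurable F) :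
    ∫⁻ y, F (y + s) * ENNReal.ofReal (Real.exp (-(β * (|y + s| - |y|)))) ∂laplaceMeasure β =
      ∫⁻ y, F y ∂laplaceMeasure β := by
  unfold laplaceMeasure
  rw [lintegral_withDensity_eq_lintegral_mul _ (measurable_laplaceDensity β) (by fun_prop),
    lintegral_withDensity_eq_lintegral_mul _ (measurable_laplaceDensity β) hF,
    ← lintegral_add_right_eq_self ((fun y => ENNReal.ofReal (β / 2 * Real.exp (-(β * |y|)))) * F) s]
  refine lintegral_congr fun y => ?_
  simp only [Pi.mul_apply]
  rw [mul_comm (F _), ← mul_assoc, ← ENNReal.ofReal_mul (by positivity), mul_assoc (β / 2),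
    ← Real.exp_add, mul_sub]
  congr 4
  ring

/-! ### Product Laplace measures. -/

section Product

variable {ι : Type*} [Fintype ι]

theorem lintegral_pi_prod {ν : ι → Measure ℝ} [∀ i, IsProbabilityMeasure (ν i)]
    {g : ι → ℝ → ℝ≥0∞} (hg : ∀ i, Measurable (g i)) :
    ∫⁻ y, ∏ i, g i (y i) ∂Measure.pi ν = ∏ i, ∫⁻ y, g i y ∂ν i := by
  refine (lintegral_prod_eq_prod_lintegral_of_indepFun Finset.univ
    (fun i (y : ι → ℝ) => g i (y i)) (iIndepFun_pi fun i => (hg i).aemeasurable)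
    (fun i => (hg i).comp (measurable_pi_apply i))).trans ?_
  refine Finset.prod_congr rfl fun i _ => ?_
  exact (measurePreserving_eval ν i).lintegral_comp (hg i)

/-- Logarithm of the likelihood ratio when Laplace noise `y` is shifted by `s`. -/
def laplaceLoss (β s y : ι → ℝ) : ℝ := ∑ i, β i * (|y i + s i| - |y i|)

theorem abs_laplaceLoss_le {β : ι → ℝ} (hβ : ∀ i, 0 < β i) (s y : ι → ℝ) :
    |laplaceLoss β s y| ≤ ∑ i, β i * |s i| := by
  refine (Finset.abs_sum_le_sum_abs _ _).trans (Finset.sum_le_sum fun i _ => ?_)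
  rw [abs_mul, abs_of_pos (hβ i)]
  refine mul_le_mul_of_nonneg_left ?_ (hβ i).le
  simpa using abs_abs_sub_abs_le_abs_sub (y i + s i) (y i)

theorem ofReal_exp_mul_laplaceLoss (β s y : ι → ℝ) (t : ℝ) :
    ENNReal.ofReal (Real.exp (t * laplaceLoss β s y)) =
      ∏ i, ENNReal.ofReal (Real.exp (t * (β i * (|y i + s i| - |y i|)))) := by
  rw [laplaceLoss, Finset.mul_sum, Real.exp_sum, ENNReal.ofReal_prod_of_nonneg
    fun i _ => (Real.exp_pos _).le]

theorem lintegral_pi_laplace_shift {β : ι → ℝ} (hβ : ∀ i, 0 < β i)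
    [∀ i, IsProbabilityMeasure (laplaceMeasure (β i))] (s : ι → ℝ) {F : (ι → ℝ) → ℝ≥0∞}
    (hF : Measurable F) :
    ∫⁻ y, F (y + s) * ENNReal.ofReal (Real.exp (-laplaceLoss β s y))
        ∂Measure.pi (fun i => laplaceMeasure (β i)) =
      ∫⁻ y, F y ∂Measure.pi (fun i => laplaceMeasure (β i)) := by
  have hg : ∀ i, Measurable fun y : ℝ =>
      ENNReal.ofReal (Real.exp (-1 * (β i * (|y + s i| - |y|)))) := fun i => by fun_prop
  have hG : Measurable fun y : ι → ℝ => ENNReal.ofReal (Real.exp (-laplaceLoss β s y)) := by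
    unfold laplaceLoss; fun_prop
  -- A product measure is determined by boxes, and on boxes the claim factors into the
  -- one-dimensional shifts.
  have key : Measure.pi (fun i => laplaceMeasure (β i)) =
      ((Measure.pi (fun i => laplaceMeasure (β i))).withDensity
        (fun y => ENNReal.ofReal (Real.exp (-laplaceLoss β s y)))).map (· + s) := by
    refine Measure.pi_eq fun S hS => ?_
    rw [Measure.map_apply (by fun_prop) (MeasurableSet.univ_pi hS),
      withDensity_apply _ ((measurable_add_const s) (MeasurableSet.univ_pi hS)),
      ← lintegral_indicator ((measurable_add_const s) (MeasurableSet.univ_pi hS))]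
    calc _ = ∫⁻ y, ∏ i, ((S i).indicator 1 (y i + s i) *
          ENNReal.ofReal (Real.exp (-1 * (β i * (|y i + s i| - |y i|)))))
          ∂Measure.pi (fun i => laplaceMeasure (β i)) := by
          refine lintegral_congr fun y => ?_
          rw [Finset.prod_mul_distrib, ← ofReal_exp_mul_laplaceLoss, neg_one_mul]
          by_cases hy : y + s ∈ Set.univ.pi S
          · rw [Set.indicator_of_mem (by exact hy), Finset.prod_eq_one, one_mul]
            intro i _
            exact Set.indicator_of_mem (hy i (Set.mem_univ i)) 1
          · rw [Set.indicator_of_notMem (by exact hy)]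
            obtain ⟨i, hi⟩ : ∃ i, y i + s i ∉ S i := by simpa [Set.mem_pi] using hy
            rw [Finset.prod_eq_zero (Finset.mem_univ i), zero_mul]
            exact Set.indicator_of_notMem hi _
      _ = ∏ i, ∫⁻ y, (S i).indicator 1 (y + s i) *
          ENNReal.ofReal (Real.exp (-1 * (β i * (|y + s i| - |y|)))) ∂laplaceMeasure (β i) := by
          refine lintegral_pi_prod (g := fun i y => (S i).indicator 1 (y + s i) *
            ENNReal.ofReal (Real.exp (-1 * (β i * (|y + s i| - |y|))))) fun i => ?_
          exact ((measurable_one.indicator (hS i)).comp (measurable_add_const (s i))).mul (hg i)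
      _ = _ := by
          refine Finset.prod_congr rfl fun i _ => ?_
          simp only [neg_one_mul]
          rw [lintegral_laplace_shift (hβ i) (s i) (measurable_one.indicator (hS i)),
            lintegral_indicator_one (hS i)]
  conv_rhs => rw [key]
  rw [lintegral_map hF (by fun_prop), lintegral_withDensity_eq_lintegral_mul _ hG (by fun_prop)]
  refine lintegral_congr fun y => ?_
  rw [Pi.mul_apply, mul_comm]

/-- If the shift is confined to the coordinates in `T`, the moment generating function of the loss
is that of `T.card` coordinates. -/
theorem lintegral_exp_laplaceLoss_le {β : ι → ℝ} (hβ : ∀ i, 0 < β i)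
    [∀ i, IsProbabilityMeasure (laplaceMeasure (β i))] (s : ι → ℝ) (T : Finset ι) {c t : ℝ}
    (hc : 0 < c) (ht : 0 ≤ t) (hs : ∀ i, β i * |s i| ≤ c) (hT : ∀ i ∉ T, s i = 0) :
    ∫⁻ y, ENNReal.ofReal (Real.exp (t * laplaceLoss β s y))
        ∂Measure.pi (fun i => laplaceMeasure (β i)) ≤
      ENNReal.ofReal (Real.exp (t * (t + 1) * c ^ 2 / 2)) ^ T.card := by
  simp only [ofReal_exp_mul_laplaceLoss]
  rw [lintegral_pi_prod (ν := fun i => laplaceMeasure (β i))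
    (g := fun i y => ENNReal.ofReal (Real.exp (t * (β i * (|y + s i| - |y|)))))
    (fun i => by fun_prop), ← Finset.prod_subset (Finset.subset_univ T)]
  · refine Finset.prod_le_pow_card _ _ _ fun i _ => ?_
    refine integral_exp_mul_loss_le (by fun_prop) hc ht (fun y => ?_) ?_
    · refine le_trans ?_ (hs i)
      rw [abs_mul, abs_of_pos (hβ i)]
      refine mul_le_mul_of_nonneg_left ?_ (hβ i).le
      simpa using abs_abs_sub_abs_le_abs_sub (y + s i) y
    · have := lintegral_laplace_shift (hβ i) (s i) (F := fun _ => 1) measurable_const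
      simpa using this
  · intro i _ hi
    simp [hT i hi]

end Product

/-! ### Likelihood ratios of adaptively composed randomized rounds -/

/-- `y (k + 1)` has law `ν` and is independent of the information `𝓕 k` of the first `k` rounds. -/
structure IsFreshNoise {Ω Y : Type*} {m0 : MeasurableSpace Ω} [MeasurableSpace Y]
    (𝓕 : ℕ → MeasurableSpace Ω) (y : ℕ → Ω → Y) (ν : Measure Y) (μ : Measure Ω) : Prop where
  mono : Monotone 𝓕
  le : ∀ k, 𝓕 k ≤ m0
  adapted : ∀ k, Measurable[𝓕 (k + 1)] (y (k + 1))
  law : ∀ k, μ.map (y (k + 1)) = ν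
  indep : ∀ k, Indep (𝓕 k) (MeasurableSpace.comap (y (k + 1)) inferInstance) μ

section Compose

variable {Ω Z Y : Type*}

/-- The process with `z (k + 1) = Ψ k (z k, y (k + 1))`. -/
def evolve (Ψ : ℕ → Z × Y → Z) (z0 : Ω → Z) (y : ℕ → Ω → Y) : ℕ → Ω → Z
  | 0 => z0
  | k + 1 => fun ω => Ψ k (evolve Ψ z0 y k ω, y (k + 1) ω)

/-- The losses `l k (z k, y (k + 1))` accumulated along `evolve Ψ z0 y`. -/
def accumLoss (Ψ : ℕ → Z × Y → Z) (l : ℕ → Z × Y → ℝ) (z0 : Ω → Z) (y : ℕ → Ω → Y) :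
    ℕ → Ω → ℝ
  | 0 => fun _ => 0
  | k + 1 => fun ω => accumLoss Ψ l z0 y k ω + l k (evolve Ψ z0 y k ω, y (k + 1) ω)

theorem abs_accumLoss_le {Ψ : ℕ → Z × Y → Z} {l : ℕ → Z × Y → ℝ} {z0 : Ω → Z} {y : ℕ → Ω → Y}
    {b : ℝ} (hb : ∀ k z, |l k z| ≤ b) (k : ℕ) (ω : Ω) :
    |accumLoss Ψ l z0 y k ω| ≤ k * b := by
  induction k with
  | zero => simp [accumLoss]
  | succ k ih =>
    simp only [accumLoss]
    push_cast
    refine (abs_add_le _ _).trans ?_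
    linarith [hb k (evolve Ψ z0 y k ω, y (k + 1) ω)]

variable [MeasurableSpace Z] [MeasurableSpace Y] {m0 : MeasurableSpace Ω} {μ : Measure Ω} {ν : Measure Y}
  {𝓕 : ℕ → MeasurableSpace Ω} {y : ℕ → Ω → Y} {Ψ Ψ' : ℕ → Z × Y → Z} {l : ℕ → Z × Y → ℝ}
  {z0 : Ω → Z}

theorem IsFreshNoise.measurable_evolve (h : IsFreshNoise 𝓕 y ν μ) (hΨ : ∀ k, Measurable (Ψ k))
    (hz : Measurable[𝓕 0] z0) (k : ℕ) : Measurable[𝓕 k] (evolve Ψ z0 y k) := by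
  induction k with
  | zero => exact hz
  | succ k ih =>
    exact (hΨ k).comp ((ih.mono (h.mono k.le_succ) le_rfl).prodMk (h.adapted k))

theorem IsFreshNoise.measurable_accumLoss (h : IsFreshNoise 𝓕 y ν μ)
    (hΨ : ∀ k, Measurable (Ψ k)) (hl : ∀ k, Measurable (l k)) (hz : Measurable[𝓕 0] z0) (k : ℕ) :
    Measurable[𝓕 k] (accumLoss Ψ l z0 y k) := by
  induction k with
  | zero => exact measurable_const
  | succ k ih =>
    exact (ih.mono (h.mono k.le_succ) le_rfl).add ((hl k).comp
      (((h.measurable_evolve hΨ hz k).mono (h.mono k.le_succ) le_rfl).prodMk (h.adapted k)))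

/-- Independence makes the joint law a product, so the noise of the next round can be integrated out
with the past held fixed. All adaptive composition below goes through this identity. -/
theorem IsFreshNoise.lintegral_eq [IsProbabilityMeasure μ] [SFinite ν] (h : IsFreshNoise 𝓕 y ν μ) {X : Type*}
    [MeasurableSpace X] {W : Ω → X} {k : ℕ} (hW : Measurable[𝓕 k] W) {G : X × Y → ℝ≥0∞}
    (hG : Measurable G) :
    ∫⁻ ω, G (W ω, y (k + 1) ω) ∂μ = ∫⁻ ω, ∫⁻ v, G (W ω, v) ∂ν ∂μ := by
  have hW' : Measurable W := hW.mono (h.le k) le_rfl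
  have hy : Measurable (y (k + 1)) := (h.adapted k).mono (h.le _) le_rfl
  have hind : IndepFun W (y (k + 1)) μ := by
    rw [IndepFun_iff_Indep]
    exact indep_of_indep_of_le_left (h.indep k) hW.comap_le
  have hmap := (indepFun_iff_map_prod_eq_prod_map_map hW'.aemeasurable hy.aemeasurable).1 hind
  rw [h.law k] at hmap
  rw [← lintegral_map (f := G) hG (hW'.prodMk hy), hmap, lintegral_prod _ hG.aemeasurable,
    lintegral_map hG.lintegral_prod_right' hW']

theorem measurable_ofReal_exp {X : Type*} [MeasurableSpace X] {g : X → ℝ} (hg : Measurable g) :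
    Measurable fun x => ENNReal.ofReal (Real.exp (g x)) :=
  (Real.measurable_exp.comp hg).ennreal_ofReal

/-- Change of measure along the whole run. Integrating out the last round replaces `Ψ` by `Ψ'`
there, and the result is again a test function of the previous state; hence the induction is over
all `F`. -/
theorem lintegral_evolve_mul_exp_neg_loss [IsProbabilityMeasure μ] [SFinite ν] (h : IsFreshNoise 𝓕 y ν μ)
    (hΨ : ∀ k, Measurable (Ψ k)) (hΨ' : ∀ k, Measurable (Ψ' k)) (hl : ∀ k, Measurable (l k))
    (hz : Measurable[𝓕 0] z0)
    (hshift : ∀ k z (F : Z → ℝ≥0∞), Measurable F →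
      ∫⁻ v, F (Ψ k (z, v)) * ENNReal.ofReal (Real.exp (-l k (z, v))) ∂ν =
        ∫⁻ v, F (Ψ' k (z, v)) ∂ν) (k : ℕ) {F : Z → ℝ≥0∞} (hF : Measurable F) :
    ∫⁻ ω, F (evolve Ψ z0 y k ω) * ENNReal.ofReal (Real.exp (-accumLoss Ψ l z0 y k ω)) ∂μ =
      ∫⁻ ω, F (evolve Ψ' z0 y k ω) ∂μ := by
  induction k generalizing F with
  | zero => simp [evolve, accumLoss]
  | succ k ih =>
    have hG : Measurable fun w : (Z × ℝ) × Y => F (Ψ k (w.1.1, w.2)) *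
        ENNReal.ofReal (Real.exp (-(w.1.2 + l k (w.1.1, w.2)))) := by
      have h1 : Measurable fun w : (Z × ℝ) × Y => (w.1.1, w.2) := by fun_prop
      refine (hF.comp ((hΨ k).comp h1)).mul (measurable_ofReal_exp ?_)
      exact (measurable_fst.snd.add ((hl k).comp h1)).neg
    have hG' : Measurable fun w : Z × Y => F (Ψ' k w) := hF.comp (hΨ' k)
    have e1 := h.lintegral_eq ((h.measurable_evolve hΨ hz k).prodMk
      (h.measurable_accumLoss hΨ hl hz k)) hG
    have e2 := h.lintegral_eq (h.measurable_evolve hΨ' hz k) hG'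
    simp only [evolve, accumLoss]
    rw [e1, e2, ← ih (F := fun z => ∫⁻ v, F (Ψ' k (z, v)) ∂ν) hG'.lintegral_prod_right']
    refine lintegral_congr fun ω => ?_
    rw [← hshift k _ F hF, ← lintegral_mul_const _ (by
      refine (hF.comp ((hΨ k).comp measurable_prodMk_left)).mul (measurable_ofReal_exp ?_)
      exact ((hl k).comp measurable_prodMk_left).neg)]
    refine lintegral_congr fun v => ?_
    rw [neg_add, add_comm, Real.exp_add, ENNReal.ofReal_mul (Real.exp_pos _).le, mul_assoc]

/-- The bound `C` is uniform in the current state, so each round contributes one factor even though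
its loss depends on the past. -/
theorem lintegral_exp_accumLoss_le [IsProbabilityMeasure μ] [SFinite ν] (h : IsFreshNoise 𝓕 y ν μ)
    (hΨ : ∀ k, Measurable (Ψ k)) (hl : ∀ k, Measurable (l k)) (hz : Measurable[𝓕 0] z0)
    {t : ℝ} {C : ℝ≥0∞}
    (hC : ∀ k z, ∫⁻ v, ENNReal.ofReal (Real.exp (t * l k (z, v))) ∂ν ≤ C) (k : ℕ) :
    ∫⁻ ω, ENNReal.ofReal (Real.exp (t * accumLoss Ψ l z0 y k ω)) ∂μ ≤ C ^ k := by
  induction k with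
  | zero => simp [accumLoss]
  | succ k ih =>
    have hG : Measurable fun w : (Z × ℝ) × Y => ENNReal.ofReal (Real.exp (t * w.1.2)) *
        ENNReal.ofReal (Real.exp (t * l k (w.1.1, w.2))) := by
      have h1 : Measurable fun w : (Z × ℝ) × Y => (w.1.1, w.2) := by fun_prop
      exact (measurable_ofReal_exp (measurable_fst.snd.const_mul t)).mul
        (measurable_ofReal_exp (((hl k).comp h1).const_mul t))
    have e1 := h.lintegral_eq ((h.measurable_evolve hΨ hz k).prodMk
      (h.measurable_accumLoss hΨ hl hz k)) hG
    simp only [accumLoss, mul_add, Real.exp_add, ENNReal.ofReal_mul (Real.exp_pos _).le]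
    rw [e1, pow_succ]
    calc _ ≤ ∫⁻ ω, ENNReal.ofReal (Real.exp (t * accumLoss Ψ l z0 y k ω)) * C ∂μ := by
          refine lintegral_mono fun ω => ?_
          dsimp only
          have hlk : Measurable fun v => l k (evolve Ψ z0 y k ω, v) :=
            (hl k).comp measurable_prodMk_left
          rw [lintegral_const_mul _ (measurable_ofReal_exp (hlk.const_mul t))]
          gcongr
          exact hC k _
      _ = (∫⁻ ω, ENNReal.ofReal (Real.exp (t * accumLoss Ψ l z0 y k ω)) ∂μ) * C :=
          lintegral_mul_const _ (measurable_ofReal_exp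
            (((h.measurable_accumLoss hΨ hl hz k).mono (h.le k) le_rfl).const_mul t))
      _ ≤ _ := by gcongr

/-- Where the accumulated loss `L` is at most `ε`, one has `1 ≤ exp ε * exp (-L)`, and the change of
measure turns the integral of the right side over the event into a probability for `Ψ'`. The rest of
the event is charged to the tail of `L`. -/
theorem measure_evolve_le [IsProbabilityMeasure μ] [SFinite ν] (h : IsFreshNoise 𝓕 y ν μ)
    (hΨ : ∀ k, Measurable (Ψ k)) (hΨ' : ∀ k, Measurable (Ψ' k)) (hl : ∀ k, Measurable (l k))
    (hz : Measurable[𝓕 0] z0)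
    (hshift : ∀ k z (F : Z → ℝ≥0∞), Measurable F →
      ∫⁻ v, F (Ψ k (z, v)) * ENNReal.ofReal (Real.exp (-l k (z, v))) ∂ν =
        ∫⁻ v, F (Ψ' k (z, v)) ∂ν) (k : ℕ) {S : Set Z} (hS : MeasurableSet S) (ε : ℝ) :
    μ (evolve Ψ z0 y k ⁻¹' S) ≤ ENNReal.ofReal (Real.exp ε) * μ (evolve Ψ' z0 y k ⁻¹' S) +
      μ {ω | ε < accumLoss Ψ l z0 y k ω} := by
  have hm := (h.measurable_evolve hΨ hz k).mono (h.le k) le_rfl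
  have hm' := (h.measurable_evolve hΨ' hz k).mono (h.le k) le_rfl
  have hL := (h.measurable_accumLoss hΨ hl hz k).mono (h.le k) le_rfl
  have key := lintegral_evolve_mul_exp_neg_loss h hΨ hΨ' hl hz hshift k
    (F := S.indicator 1) (measurable_one.indicator hS)
  have e : ∫⁻ ω, S.indicator 1 (evolve Ψ' z0 y k ω) ∂μ = μ (evolve Ψ' z0 y k ⁻¹' S) := by
    rw [← lintegral_indicator_one (hm' hS)]; rfl
  rw [e] at key
  have hsub : evolve Ψ z0 y k ⁻¹' S ⊆
      (evolve Ψ z0 y k ⁻¹' S ∩ {ω | accumLoss Ψ l z0 y k ω ≤ ε}) ∪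
        {ω | ε < accumLoss Ψ l z0 y k ω} := fun ω hω => by
    rcases le_or_gt (accumLoss Ψ l z0 y k ω) ε with h1 | h1
    · exact Or.inl ⟨hω, h1⟩
    · exact Or.inr h1
  refine (measure_mono hsub).trans ((measure_union_le _ _).trans (add_le_add_left ?_ _))
  have hmeas : MeasurableSet (evolve Ψ z0 y k ⁻¹' S ∩ {ω | accumLoss Ψ l z0 y k ω ≤ ε}) :=
    (hm hS).inter (measurableSet_le hL measurable_const)
  have hprod : Measurable fun ω => S.indicator 1 (evolve Ψ z0 y k ω) *
      ENNReal.ofReal (Real.exp (-accumLoss Ψ l z0 y k ω)) :=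
    ((measurable_one.indicator hS).comp hm).mul (measurable_ofReal_exp hL.neg)
  rw [← lintegral_indicator_one hmeas, ← key, ← lintegral_const_mul _ hprod]
  refine lintegral_mono fun ω => ?_
  by_cases hω : ω ∈ evolve Ψ z0 y k ⁻¹' S ∩ {ω | accumLoss Ψ l z0 y k ω ≤ ε}
  · have h1 : S.indicator (1 : Z → ℝ≥0∞) (evolve Ψ z0 y k ω) = 1 := Set.indicator_of_mem hω.1 1
    have h2 : accumLoss Ψ l z0 y k ω ≤ ε := hω.2
    rw [Set.indicator_of_mem hω, h1, one_mul, ← ENNReal.ofReal_mul (Real.exp_pos _).le,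
      ← Real.exp_add, Pi.one_apply, ENNReal.one_le_ofReal, Real.one_le_exp_iff]
    linarith
  · rw [Set.indicator_of_notMem hω]
    exact bot_le

theorem measure_lt_accumLoss_le [IsProbabilityMeasure μ] [SFinite ν] (h : IsFreshNoise 𝓕 y ν μ)
    (hΨ : ∀ k, Measurable (Ψ k)) (hl : ∀ k, Measurable (l k)) (hz : Measurable[𝓕 0] z0)
    {t : ℝ} (ht : 0 ≤ t) {C : ℝ≥0∞}
    (hC : ∀ k z, ∫⁻ v, ENNReal.ofReal (Real.exp (t * l k (z, v))) ∂ν ≤ C) (k : ℕ) (ε : ℝ) :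
    μ {ω | ε < accumLoss Ψ l z0 y k ω} ≤ C ^ k * ENNReal.ofReal (Real.exp (-(t * ε))) := by
  have hL := (h.measurable_accumLoss hΨ hl hz k).mono (h.le k) le_rfl
  have hmeas : MeasurableSet {ω | ε < accumLoss Ψ l z0 y k ω} :=
    measurableSet_lt measurable_const hL
  rw [← lintegral_indicator_one hmeas]
  calc _ ≤ ∫⁻ ω, ENNReal.ofReal (Real.exp (t * accumLoss Ψ l z0 y k ω)) *
        ENNReal.ofReal (Real.exp (-(t * ε))) ∂μ := by
        refine lintegral_mono fun ω => ?_
        by_cases hω : ω ∈ {ω | ε < accumLoss Ψ l z0 y k ω}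
        · have h2 : ε < accumLoss Ψ l z0 y k ω := hω
          rw [Set.indicator_of_mem hω, ← ENNReal.ofReal_mul (Real.exp_pos _).le,
            ← Real.exp_add, Pi.one_apply, ENNReal.one_le_ofReal, Real.one_le_exp_iff]
          nlinarith
        · rw [Set.indicator_of_notMem hω]
          exact bot_le
    _ = (∫⁻ ω, ENNReal.ofReal (Real.exp (t * accumLoss Ψ l z0 y k ω)) ∂μ) *
        ENNReal.ofReal (Real.exp (-(t * ε))) :=
        lintegral_mul_const _ (measurable_ofReal_exp (hL.const_mul t))
    _ ≤ _ := by
        gcongr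
        exact lintegral_exp_accumLoss_le h hΨ hl hz hC k

end Compose

/-- The law of `(a, (b, c))` is a product of three factors, which may be bracketed either way. -/
theorem indepFun_prodMk_left {Ω α β γ : Type*} [MeasurableSpace Ω] [MeasurableSpace α]
    [MeasurableSpace β] [MeasurableSpace γ] {μ : Measure Ω} [IsProbabilityMeasure μ]
    {a : Ω → α} {b : Ω → β} {c : Ω → γ} (ha : Measurable a) (hb : Measurable b)
    (hc : Measurable c) (h1 : IndepFun a (fun ω => (b ω, c ω)) μ) (h2 : IndepFun b c μ) :
    IndepFun (fun ω => (a ω, b ω)) c μ := by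
  have h3 : IndepFun a b μ := h1.comp measurable_id measurable_fst
  have := Measure.isProbabilityMeasure_map (μ := μ) ha.aemeasurable
  have := Measure.isProbabilityMeasure_map (μ := μ) hb.aemeasurable
  have := Measure.isProbabilityMeasure_map (μ := μ) hc.aemeasurable
  rw [indepFun_iff_map_prod_eq_prod_map_map (by fun_prop) (by fun_prop)] at h1 h2 h3 ⊢
  rw [h3]
  have e : (fun ω => ((a ω, b ω), c ω)) =
      MeasurableEquiv.prodAssoc.symm ∘ fun ω => (a ω, (b ω, c ω)) := rfl
  rw [e, ← Measure.map_map (MeasurableEquiv.measurable _) (by fun_prop), h1, h2]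
  exact (measurePreserving_prodAssoc _ _ _).symm.map_eq

/-! ### Measurability of the iteration -/

section Measurability

variable {N d q : ℕ} {A : Fin N → Vec d →L[ℝ] Vec q} {c : Vec q} {D : Fin N → ℝ} {ζ : ℝ}
  {f : Fin N → Vec d → ℝ}

theorem continuous_diagMul {X : Type*} [TopologicalSpace X] {g : X → Fin q → ℝ} {h : X → Vec q}
    (hg : Continuous g) (hh : Continuous h) : Continuous fun x => diagMul (g x) (h x) := by
  unfold PrivateADMM.diagMul
  fun_prop

theorem continuous_primalStep (hf : ∀ i, Continuous (gradient (f i))) (i : Fin N) :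
    Continuous fun w : (Fin N → Fin q → ℝ) × (Fin N → Vec d) × State N d q =>
      primalStep A c D f w.1 w.2.1 w.2.2 i := by
  have hfi := hf i
  have h1 : Continuous fun w : (Fin N → Fin q → ℝ) × (Fin N → Vec d) × State N d q =>
      diagMul (w.1 i) (∑ j ∈ Finset.univ.erase i, A j (w.2.2.1 j) - c) :=
    continuous_diagMul (by fun_prop) (by fun_prop)
  have h2 : Continuous fun w : (Fin N → Fin q → ℝ) × (Fin N → Vec d) × State N d q =>
      diagMul (w.1 i) (A i (w.2.2.1 i)) := continuous_diagMul (by fun_prop) (by fun_prop)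
  unfold primalStep Gam
  fun_prop

theorem measurable_step (hf : ∀ i, Continuous (gradient (f i))) {X : Type*} [MeasurableSpace X]
    {r : X → Fin N → Fin q → ℝ} {n : X → Fin N → Vec d} {u : X → State N d q}
    (hr : Measurable r) (hn : Measurable n) (hu : Measurable u) :
    Measurable fun x => step A c D ζ f (r x) (n x) (u x) := by
  have h : ∀ i, Measurable fun x => primalStep A c D f (r x) (n x) (u x) i := by
    intro i
    have h1 := (continuous_primalStep (A := A) (c := c) (D := D) hf i).measurable
    have h2 := hr.prodMk (hn.prodMk hu)
    have h3 := h1.comp h2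
    exact h3
  have h2 : Measurable fun x => (u x).2 - ζ • (∑ i, A i (primalStep A c D f (r x) (n x) (u x) i) - c) :=
    hu.snd.sub (((Finset.measurable_sum _ fun i _ =>
      (A i).continuous.measurable.comp (h i)).sub_const c).const_smul ζ)
  exact (measurable_pi_lambda _ h).prodMk h2

theorem measurable_iter (hf : ∀ i, Continuous (gradient (f i))) {Ω : Type*} [MeasurableSpace Ω]
    {ρ : Ω → ℕ → Fin N → Fin q → ℝ} {noise : Ω → ℕ → Fin N → Vec d} {u0 : Ω → State N d q}
    (hρ : Measurable ρ) (hn : Measurable noise) (hu : Measurable u0) (k : ℕ) :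
    Measurable fun ω => iter A c D ζ f (ρ ω) (noise ω) (u0 ω) k := by
  induction k with
  | zero => exact hu
  | succ k ih =>
    exact measurable_step hf ((measurable_pi_apply (k + 1)).comp hρ)
      ((measurable_pi_apply (k + 1)).comp hn) ih

end Measurability

/-! ### The noise of a run -/

section Noise

variable {N d q : ℕ} {Ω : Type*} [MeasurableSpace Ω] {μ : Measure Ω} {m D σ : Fin N → ℝ}
  {α ρ₀ : ℝ} {β : Fin N → ℝ} {x0 : Ω → Fin N → Vec d} {ρ : Ω → ℕ → Fin N → Fin q → ℝ}
  {noise : Ω → ℕ → Fin N → Vec d}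

/-- The noise coordinates of round `k`. -/
def noiseCoord (noise : Ω → ℕ → Fin N → Vec d) (k : ℕ) (ω : Ω) (t : Fin N × Fin d) : ℝ :=
  noise ω k t.1 t.2

/-- Initial point, penalties, and the noise of the rounds up to `k`. -/
def past (x0 : Ω → Fin N → Vec d) (ρ : Ω → ℕ → Fin N → Fin q → ℝ)
    (noise : Ω → ℕ → Fin N → Vec d) (k : ℕ) (ω : Ω) :
    ((Fin N → Vec d) × (ℕ → Fin N → Fin q → ℝ)) × (ℕ → Fin N → Vec d) :=
  ((x0 ω, ρ ω), fun j => if j ≤ k then noise ω j else 0)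

theorem measurable_truncate {P : Type*} [MeasurableSpace P] {g : P → ℕ → Fin N → Vec d}
    (hg : Measurable g) (k : ℕ) : Measurable fun p j => if j ≤ k then g p j else 0 := by
  refine measurable_pi_lambda _ fun j => ?_
  split_ifs
  · exact (measurable_pi_apply j).comp hg
  · exact measurable_const

theorem IsLaplaceRun.measurable_past (h : IsLaplaceRun μ m D σ α ρ₀ β x0 ρ noise) (k : ℕ) :
    Measurable (past x0 ρ noise k) :=
  (h.measurable_x0.prodMk h.measurable_ρ).prodMk (measurable_truncate h.measurable_noise k)

theorem IsLaplaceRun.measurable_coord (h : IsLaplaceRun μ m D σ α ρ₀ β x0 ρ noise)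
    (k : ℕ) (i : Fin N) (l : Fin d) : Measurable fun ω => noise ω k i l := by
  have := h.measurable_noise
  fun_prop

/-- No normalizing integral is needed: the measure is the law of a noise coordinate. -/
theorem IsLaplaceRun.isProbabilityMeasure [IsProbabilityMeasure μ]
    (h : IsLaplaceRun μ m D σ α ρ₀ β x0 ρ noise)
    (i : Fin N) (l : Fin d) : IsProbabilityMeasure (laplaceMeasure (β i)) :=
  h.law 0 i l ▸ Measure.isProbabilityMeasure_map (h.measurable_coord 0 i l).aemeasurable

theorem IsLaplaceRun.indep_truncate (h : IsLaplaceRun μ m D σ α ρ₀ β x0 ρ noise) (k : ℕ) :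
    IndepFun (fun ω j => if j ≤ k then noise ω j else 0) (noiseCoord noise (k + 1)) μ := by
  classical
  set S : Finset (ℕ × Fin N × Fin d) := Finset.range (k + 1) ×ˢ Finset.univ with hS
  set T : Finset (ℕ × Fin N × Fin d) := {k + 1} ×ˢ Finset.univ with hT
  have hST : Disjoint S T := by
    rw [Finset.disjoint_left]
    rintro ⟨j, t⟩ h1 h2
    simp only [hS, hT, Finset.mem_product, Finset.mem_range, Finset.mem_singleton,
      Finset.mem_univ, and_true] at h1 h2
    omega
  have hind := h.indep.indepFun_finset S T hST fun t => h.measurable_coord _ _ _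
  let φ : (S → ℝ) → ℕ → Fin N → Vec d := fun v j i =>
    WithLp.toLp 2 fun l => if ht : (j, i, l) ∈ S then v ⟨(j, i, l), ht⟩ else 0
  let ψ : (T → ℝ) → Fin N × Fin d → ℝ := fun v t => v ⟨(k + 1, t), by simp [hT]⟩
  have hφ : Measurable φ := by
    refine measurable_pi_lambda _ fun j => measurable_pi_lambda _ fun i => ?_
    refine (WithLp.measurable_toLp 2 _).comp (measurable_pi_lambda _ fun l => ?_)
    split_ifs
    · exact measurable_pi_apply _
    · exact measurable_const
  have hψ : Measurable ψ := measurable_pi_lambda _ fun t => measurable_pi_apply _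
  have e : (fun ω j => if j ≤ k then noise ω j else 0) =
      φ ∘ fun ω (t : S) => noise ω t.1.1 t.1.2.1 t.1.2.2 := by
    funext ω j i
    ext l
    by_cases hj : j ≤ k <;> simp [φ, hS, hj]
  rw [e]
  exact hind.comp hφ hψ

theorem IsLaplaceRun.isFreshNoise [IsProbabilityMeasure μ]
    (h : IsLaplaceRun μ m D σ α ρ₀ β x0 ρ noise) :
    IsFreshNoise (fun k => MeasurableSpace.comap (past x0 ρ noise k) inferInstance)
      (noiseCoord noise) (Measure.pi fun t : Fin N × Fin d => laplaceMeasure (β t.1)) μ where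
  mono := monotone_nat_of_le_succ fun k => by
    have e : past x0 ρ noise k = (fun p => (p.1, fun j => if j ≤ k then p.2 j else 0)) ∘
        past x0 ρ noise (k + 1) := by
      funext ω
      refine Prod.ext rfl (funext fun j => ?_)
      by_cases hj : j ≤ k
      · simp [past, hj, hj.trans k.le_succ]
      · simp [past, hj]
    rw [e, ← MeasurableSpace.comap_comp]
    exact MeasurableSpace.comap_mono
      (measurable_fst.prodMk (measurable_truncate measurable_snd k)).comap_le
  le k := (h.measurable_past k).comap_le
  adapted k := by
    have e : noiseCoord noise (k + 1) =
        (fun p (t : Fin N × Fin d) => p.2 (k + 1) t.1 t.2) ∘ past x0 ρ noise (k + 1) := by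
      funext ω t
      simp [past, noiseCoord]
    rw [e]
    refine Measurable.comp ?_ (comap_measurable _)
    refine measurable_pi_lambda _ fun t => ?_
    fun_prop
  law k := by
    have h1 := h.indep.precomp (g := fun t : Fin N × Fin d => (k + 1, t)) fun a b hab => by
      simpa using hab
    have h2 := h1.map_fun_eq_pi_map fun t => (h.measurable_coord _ _ _).aemeasurable
    refine h2.trans ?_
    congr 1
    funext t
    exact h.law (k + 1) t.1 t.2
  indep k := by
    have hy : Measurable (noiseCoord noise (k + 1)) :=
      measurable_pi_lambda _ fun t => h.measurable_coord _ _ _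
    have hg : Measurable fun n : ℕ → Fin N → Vec d =>
        ((fun j => if j ≤ k then n j else 0 : ℕ → Fin N → Vec d),
          fun t : Fin N × Fin d => n (k + 1) t.1 t.2) := by
      refine (measurable_truncate measurable_id k).prodMk (measurable_pi_lambda _ fun t => ?_)
      fun_prop
    -- Parameters are independent of all the noise jointly, and earlier noise is independent of the
    -- noise of round `k + 1`.
    exact (IndepFun_iff_Indep _ _ _).1 (indepFun_prodMk_left
      (h.measurable_x0.prodMk h.measurable_ρ) (measurable_truncate h.measurable_noise k) hy
      (h.indep_param.comp measurable_id hg) (h.indep_truncate k))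

end Noise

/-! ### Privacy -/

section Privacy

variable {N d q : ℕ} {Ω : Type*} {A : Fin N → Vec d →L[ℝ] Vec q} {c : Vec q} {D : Fin N → ℝ}
  {ζ : ℝ} {f f' : Fin N → Vec d → ℝ}

/-- Penalties together with the states reached so far. -/
abbrev Hist (N d q : ℕ) : Type := (ℕ → Fin N → Fin q → ℝ) × (ℕ → State N d q)

/-- Assemble noise vectors from their coordinates. -/
def toNoise (v : Fin N × Fin d → ℝ) (i : Fin N) : Vec d := WithLp.toLp 2 fun l => v (i, l)

/-- Round `k + 1` as an update of the history. -/
def histStep (A : Fin N → Vec d →L[ℝ] Vec q) (c : Vec q) (D : Fin N → ℝ) (ζ : ℝ)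
    (f : Fin N → Vec d → ℝ) (k : ℕ) (w : Hist N d q × (Fin N × Fin d → ℝ)) : Hist N d q :=
  (w.1.1, fun j => if j ≤ k then w.1.2 j else
    step A c D ζ f (w.1.1 (k + 1)) (toNoise w.2) (w.1.2 k))

/-- The noise shift that compensates the replacement of `f` by `f'`. -/
def gradShift (D : Fin N → ℝ) (f f' : Fin N → Vec d → ℝ) (x : Fin N → Vec d)
    (t : Fin N × Fin d) : ℝ :=
  (D t.1)⁻¹ * (gradient (f' t.1) (x t.1) t.2 - gradient (f t.1) (x t.1) t.2)

theorem measurable_histStep (hf : ∀ i, Continuous (gradient (f i))) (k : ℕ) :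
    Measurable (histStep A c D ζ f k) := by
  refine measurable_fst.fst.prodMk (measurable_pi_lambda _ fun j => ?_)
  have h1 : Measurable (toNoise : (Fin N × Fin d → ℝ) → Fin N → Vec d) :=
    measurable_pi_lambda _ fun i => (WithLp.measurable_toLp 2 _).comp
      (measurable_pi_lambda _ fun l => measurable_pi_apply _)
  split_ifs
  · exact (measurable_pi_apply j).comp measurable_fst.snd
  · exact measurable_step hf ((measurable_pi_apply (k + 1)).comp measurable_fst.fst)
      (h1.comp measurable_snd) ((measurable_pi_apply k).comp measurable_fst.snd)

/-- The private gradient enters the update only as the additive term `-Dᵢ⁻¹ ∇fᵢ(xᵢ)`, so changing it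
is indistinguishable from shifting the noise. -/
theorem histStep_shift (k : ℕ) (z : Hist N d q) (v : Fin N × Fin d → ℝ) :
    histStep A c D ζ f k (z, v) =
      histStep A c D ζ f' k (z, v + gradShift D f f' (z.2 k).1) := by
  have h : ∀ i, primalStep A c D f (z.1 (k + 1)) (toNoise v) (z.2 k) i =
      primalStep A c D f' (z.1 (k + 1)) (toNoise (v + gradShift D f f' (z.2 k).1)) (z.2 k) i := by
    intro i
    have e : toNoise (v + gradShift D f f' (z.2 k).1) i = toNoise v i +
        (D i)⁻¹ • (gradient (f' i) ((z.2 k).1 i) - gradient (f i) ((z.2 k).1 i)) := by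
      ext l; simp [toNoise, gradShift]
    rw [primalStep, primalStep, e]
    simp only [smul_sub]
    abel
  unfold histStep step
  simp only [h, funext h]

/-- Round `k + 1` writes the new state into every position above `k`, to be overwritten later; hence
the `min`. The full history is kept because events concern the whole transcript. -/
theorem evolve_histStep {x0 : Ω → Fin N → Vec d} {ρ : Ω → ℕ → Fin N → Fin q → ℝ}
    {noise : Ω → ℕ → Fin N → Vec d} (lam0 : Vec q) (k : ℕ) (ω : Ω) :
    evolve (histStep A c D ζ f) (fun ω => (ρ ω, fun _ => (x0 ω, lam0))) (noiseCoord noise) k ω =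
      (ρ ω, fun j => iter A c D ζ f (ρ ω) (noise ω) (x0 ω, lam0) (min j k)) := by
  induction k with
  | zero => simp [evolve, iter]
  | succ k ih =>
    simp only [evolve, ih, histStep]
    refine Prod.ext rfl (funext fun j => ?_)
    dsimp only
    split_ifs with hj
    · rw [min_eq_left hj, min_eq_left (hj.trans k.le_succ)]
    · rw [min_self, min_eq_right (by omega : k + 1 ≤ j), iter]
      rfl

/-- The loss of round `k + 1`. -/
def histLoss (D β : Fin N → ℝ) (f f' : Fin N → Vec d → ℝ) (k : ℕ)
    (w : Hist N d q × (Fin N × Fin d → ℝ)) : ℝ :=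
  laplaceLoss (fun t => β t.1) (gradShift D f f' (w.1.2 k).1) w.2

theorem measurable_histLoss (hf : ∀ i, Continuous (gradient (f i)))
    (hf' : ∀ i, Continuous (gradient (f' i))) (β : Fin N → ℝ) (k : ℕ) :
    Measurable (histLoss D β f f' k : Hist N d q × (Fin N × Fin d → ℝ) → ℝ) := by
  have hg : ∀ t : Fin N × Fin d, Measurable fun w : Hist N d q × (Fin N × Fin d → ℝ) =>
      gradShift D f f' (w.1.2 k).1 t := by
    intro t
    have h1 : Continuous fun x : Vec d =>
        (D t.1)⁻¹ * (gradient (f' t.1) x t.2 - gradient (f t.1) x t.2) := by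
      have := hf t.1
      have := hf' t.1
      fun_prop
    exact h1.measurable.comp (by fun_prop)
  unfold histLoss laplaceLoss
  fun_prop

theorem lintegral_histStep_shift {β : Fin N → ℝ} (hβ : ∀ i, 0 < β i)
    [∀ t : Fin N × Fin d, IsProbabilityMeasure (laplaceMeasure (β t.1))]
    (hf : ∀ i, Continuous (gradient (f' i)))
    (k : ℕ) (z : Hist N d q) (F : Hist N d q → ℝ≥0∞) (hF : Measurable F) :
    ∫⁻ v, F (histStep A c D ζ f k (z, v)) *
        ENNReal.ofReal (Real.exp (-histLoss D β f f' k (z, v)))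
        ∂Measure.pi (fun t : Fin N × Fin d => laplaceMeasure (β t.1)) =
      ∫⁻ v, F (histStep A c D ζ f' k (z, v))
        ∂Measure.pi (fun t : Fin N × Fin d => laplaceMeasure (β t.1)) := by
  have h := lintegral_pi_laplace_shift (β := fun t : Fin N × Fin d => β t.1) (fun t => hβ t.1)
    (gradShift D f f' (z.2 k).1) (F := fun v => F (histStep A c D ζ f' k (z, v)))
    (hF.comp ((measurable_histStep hf k).comp measurable_prodMk_left))
  rw [← h]
  refine lintegral_congr fun v => ?_
  rw [histStep_shift (f' := f')]
  rfl

theorem mul_abs_gradShift_le {β : Fin N → ℝ} {i : Fin N} {B : ℝ} (hβ : 0 < β i) (hD : 0 < D i)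
    (hne : ∀ j ≠ i, f' j = f j)
    (hB : ∀ (x : Vec d) (l : Fin d), |gradient (f' i) x l - gradient (f i) x l| ≤ B)
    (x : Fin N → Vec d) (t : Fin N × Fin d) :
    β t.1 * |gradShift D f f' x t| ≤ if t.1 = i then β i * B / D i else 0 := by
  split_ifs with ht
  · subst ht
    rw [gradShift, abs_mul, abs_of_pos (inv_pos.2 hD)]
    calc _ ≤ β t.1 * ((D t.1)⁻¹ * B) := by gcongr; exact hB _ _
      _ = _ := by ring
  · simp [gradShift, hne _ ht]

theorem gradShift_eq_zero {i : Fin N} (hne : ∀ j ≠ i, f' j = f j) (x : Fin N → Vec d)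
    {t : Fin N × Fin d} (ht : t.1 ≠ i) : gradShift D f f' x t = 0 := by
  simp [gradShift, hne _ ht]

theorem abs_histLoss_le {β : Fin N → ℝ} {i : Fin N} {B : ℝ} (hβ : ∀ i, 0 < β i) (hD : 0 < D i)
    (hne : ∀ j ≠ i, f' j = f j)
    (hB : ∀ (x : Vec d) (l : Fin d), |gradient (f' i) x l - gradient (f i) x l| ≤ B)
    (k : ℕ) (w : Hist N d q × (Fin N × Fin d → ℝ)) :
    |histLoss D β f f' k w| ≤ d * (β i * B / D i) := by
  refine (abs_laplaceLoss_le (fun t : Fin N × Fin d => hβ t.1) _ _).trans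
    ((Finset.sum_le_sum fun (t : Fin N × Fin d) _ => mul_abs_gradShift_le (hβ i) hD hne hB
      (w.1.2 k).1 t).trans_eq ?_)
  rw [Fintype.sum_prod_type_right]
  simp

theorem lintegral_exp_histLoss_le {β : Fin N → ℝ} {i : Fin N} {B t : ℝ} (hβ : ∀ i, 0 < β i)
    [∀ t : Fin N × Fin d, IsProbabilityMeasure (laplaceMeasure (β t.1))]
    (hD : 0 < D i) (hBpos : 0 < B) (ht : 0 ≤ t) (hne : ∀ j ≠ i, f' j = f j)
    (hB : ∀ (x : Vec d) (l : Fin d), |gradient (f' i) x l - gradient (f i) x l| ≤ B)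
    (k : ℕ) (z : Hist N d q) :
    ∫⁻ v, ENNReal.ofReal (Real.exp (t * histLoss D β f f' k (z, v)))
        ∂Measure.pi (fun t : Fin N × Fin d => laplaceMeasure (β t.1)) ≤
      ENNReal.ofReal (Real.exp (t * (t + 1) * (β i * B / D i) ^ 2 / 2)) ^ d := by
  classical
  have hc : 0 < β i * B / D i := div_pos (mul_pos (hβ i) hBpos) hD
  have h := lintegral_exp_laplaceLoss_le (β := fun t : Fin N × Fin d => β t.1) (fun t => hβ t.1)
    (gradShift D f f' (z.2 k).1) (Finset.univ.filter fun s => s.1 = i) hc ht (fun s => by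
      refine (mul_abs_gradShift_le (hβ i) hD hne hB _ s).trans ?_
      split_ifs
      · exact le_rfl
      · exact hc.le) (fun s hs => gradShift_eq_zero hne _ (by simpa using hs))
  have hcard : (Finset.univ.filter fun s : Fin N × Fin d => s.1 = i).card = d := by
    have e : (Finset.univ.filter fun s : Fin N × Fin d => s.1 = i) = {i} ×ˢ Finset.univ := by
      ext ⟨a, b⟩; simp [eq_comm]
    rw [e, Finset.card_product]; simp
  rwa [hcard] at h

variable {x0 : Ω → Fin N → Vec d} {ρ : Ω → ℕ → Fin N → Fin q → ℝ}
  {noise : Ω → ℕ → Fin N → Vec d} {lam0 : Vec q}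

theorem measurable_initHist (lam0 : Vec q) :
    Measurable[MeasurableSpace.comap (past x0 ρ noise 0) inferInstance]
      fun ω => ((ρ ω, fun _ => (x0 ω, lam0)) : Hist N d q) := by
  have hg : Measurable fun p : ((Fin N → Vec d) × (ℕ → Fin N → Fin q → ℝ)) × (ℕ → Fin N → Vec d) =>
      ((p.1.2, fun _ => (p.1.1, lam0)) : Hist N d q) :=
    measurable_fst.snd.prodMk (measurable_pi_lambda _ fun _ =>
      measurable_fst.fst.prodMk measurable_const)
  exact hg.comp (comap_measurable (past x0 ρ noise 0))

theorem transcript_preimage (K : ℕ) (S : Set (Fin (K + 1) → Fin N → Vec d)) :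
    transcript A c D ζ lam0 K x0 ρ noise f ⁻¹' S =
      evolve (histStep A c D ζ f) (fun ω => (ρ ω, fun _ => (x0 ω, lam0))) (noiseCoord noise) K ⁻¹'
        ((fun (z : Hist N d q) (k : Fin (K + 1)) => (z.2 k).1) ⁻¹' S) := by
  ext ω
  simp only [Set.mem_preimage, evolve_histStep]
  have : ∀ k : Fin (K + 1), min (k : ℕ) K = k := fun k => min_eq_left (Nat.lt_succ_iff.1 k.2)
  simp only [this]
  rfl

variable [MeasurableSpace Ω] {μ : Measure Ω} [IsProbabilityMeasure μ] {m σ : Fin N → ℝ}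
  {α ρ₀ : ℝ} {β : Fin N → ℝ}

theorem measure_transcript_le (h : IsLaplaceRun μ m D σ α ρ₀ β x0 ρ noise) (hβ : ∀ i, 0 < β i)
    (hf : ∀ i, Continuous (gradient (f i))) (hf' : ∀ i, Continuous (gradient (f' i)))
    {K : ℕ} {S : Set (Fin (K + 1) → Fin N → Vec d)} (hS : MeasurableSet S) (ε : ℝ) :
    μ (transcript A c D ζ lam0 K x0 ρ noise f ⁻¹' S) ≤
      ENNReal.ofReal (Real.exp ε) * μ (transcript A c D ζ lam0 K x0 ρ noise f' ⁻¹' S) +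
      μ {ω | ε < accumLoss (histStep A c D ζ f) (histLoss D β f f')
        (fun ω => (ρ ω, fun _ => (x0 ω, lam0))) (noiseCoord noise) K ω} := by
  have : ∀ t : Fin N × Fin d, IsProbabilityMeasure (laplaceMeasure (β t.1)) :=
    fun t => h.isProbabilityMeasure t.1 t.2
  rw [transcript_preimage, transcript_preimage]
  refine measure_evolve_le h.isFreshNoise (measurable_histStep hf) (measurable_histStep hf')
    (measurable_histLoss hf hf' β) (measurable_initHist lam0)
    (lintegral_histStep_shift hβ hf') K ?_ ε
  have hm : Measurable fun (z : Hist N d q) (k : Fin (K + 1)) => (z.2 k).1 :=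
    measurable_pi_lambda _ fun k => ((measurable_pi_apply (k : ℕ)).comp measurable_snd).fst
  exact hm hS

theorem measure_transcript_le_pure (h : IsLaplaceRun μ m D σ α ρ₀ β x0 ρ noise)
    (hβ : ∀ i, 0 < β i) (hf : ∀ i, Continuous (gradient (f i)))
    (hf' : ∀ i, Continuous (gradient (f' i))) {i : Fin N} {B ε : ℝ} (hD : 0 < D i)
    (hne : ∀ j ≠ i, f' j = f j)
    (hB : ∀ (x : Vec d) (l : Fin d), |gradient (f' i) x l - gradient (f i) x l| ≤ B)
    {K : ℕ} (hε : K * (d * (β i * B / D i)) ≤ ε)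
    {S : Set (Fin (K + 1) → Fin N → Vec d)} (hS : MeasurableSet S) :
    μ (transcript A c D ζ lam0 K x0 ρ noise f ⁻¹' S) ≤
      ENNReal.ofReal (Real.exp ε) * μ (transcript A c D ζ lam0 K x0 ρ noise f' ⁻¹' S) := by
  refine (measure_transcript_le h hβ hf hf' hS ε).trans ?_
  have e : {ω | ε < accumLoss (histStep A c D ζ f) (histLoss D β f f')
        (fun ω => (ρ ω, fun _ => (x0 ω, lam0))) (noiseCoord noise) K ω} = ∅ := by
    refine Set.eq_empty_of_forall_notMem fun ω hω => ?_
    have h1 := abs_accumLoss_le (Ψ := histStep A c D ζ f) (z0 := fun ω => (ρ ω, fun _ => (x0 ω, lam0)))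
      (y := noiseCoord noise) (abs_histLoss_le (q := q) hβ hD hne hB) K ω
    exact absurd ((le_abs_self _).trans (h1.trans hε)) (not_le.2 hω)
  rw [e, measure_empty, add_zero]

theorem measure_transcript_le_approx (h : IsLaplaceRun μ m D σ α ρ₀ β x0 ρ noise)
    (hβ : ∀ i, 0 < β i) (hf : ∀ i, Continuous (gradient (f i)))
    (hf' : ∀ i, Continuous (gradient (f' i))) {i : Fin N} {B ε δ : ℝ} (hD : 0 < D i)
    (hBpos : 0 < B) (hne : ∀ j ≠ i, f' j = f j)
    (hB : ∀ (x : Vec d) (l : Fin d), |gradient (f' i) x l - gradient (f i) x l| ≤ B)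
    {K : ℕ} (hε0 : 0 < ε) (hε1 : ε ≤ 1) (hδ0 : 0 < δ) (hδ1 : δ < 1)
    (hε : K * d * (1 + 2 * Real.log (1 / δ)) * (β i * B / D i) ^ 2 ≤ ε ^ 2)
    {S : Set (Fin (K + 1) → Fin N → Vec d)} (hS : MeasurableSet S) :
    μ (transcript A c D ζ lam0 K x0 ρ noise f ⁻¹' S) ≤
      ENNReal.ofReal (Real.exp ε) * μ (transcript A c D ζ lam0 K x0 ρ noise f' ⁻¹' S) +
        ENNReal.ofReal δ := by
  have : ∀ t : Fin N × Fin d, IsProbabilityMeasure (laplaceMeasure (β t.1)) :=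
    fun t => h.isProbabilityMeasure t.1 t.2
  refine (measure_transcript_le h hβ hf hf' hS ε).trans ?_
  gcongr
  set s := 1 + 2 * Real.log (1 / δ) with hs
  have hlog : 0 < Real.log (1 / δ) := Real.log_pos (by rw [lt_div_iff₀ hδ0]; linarith)
  have hs1 : 1 ≤ s := by linarith
  have hsε : 1 ≤ s / ε := by rw [le_div_iff₀ hε0]; linarith
  -- The Chernoff exponent `t = s / ε - 1/2` minimizes `t (t + 1) ε² / (2 s) - t ε`. The minimum
  -- `-s/2 + ε/2 - ε² / (8 s)` is at most `log δ = -(s - 1) / 2` because `ε ≤ 1`.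
  have ht : 0 ≤ s / ε - 1 / 2 := by linarith
  refine (measure_lt_accumLoss_le h.isFreshNoise (measurable_histStep hf)
    (measurable_histLoss hf hf' β) (measurable_initHist lam0) ht
    (lintegral_exp_histLoss_le hβ hD hBpos ht hne hB) K ε).trans ?_
  rw [← pow_mul, ← ENNReal.ofReal_pow (Real.exp_pos _).le, ← Real.exp_nat_mul,
    ← ENNReal.ofReal_mul (Real.exp_pos _).le, ← Real.exp_add]
  refine ENNReal.ofReal_le_ofReal ?_
  rw [← Real.le_log_iff_exp_le hδ0]
  have hlogδ : Real.log δ = -((s - 1) / 2) := by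
    rw [hs, one_div, Real.log_inv]; ring
  rw [hlogδ]
  have hnc : K * d * (β i * B / D i) ^ 2 ≤ ε ^ 2 / s := by
    rw [le_div_iff₀ (by linarith)]
    linarith
  have h1 : ((d * K : ℕ) : ℝ) *
      ((s / ε - 1 / 2) * (s / ε - 1 / 2 + 1) * (β i * B / D i) ^ 2 / 2) ≤
      (s / ε - 1 / 2) * (s / ε - 1 / 2 + 1) / 2 * (ε ^ 2 / s) := by
    push_cast
    calc _ = (s / ε - 1 / 2) * (s / ε - 1 / 2 + 1) / 2 *
          (K * d * (β i * B / D i) ^ 2) := by ring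
      _ ≤ _ := by gcongr
  have h2 : (s / ε - 1 / 2) * (s / ε - 1 / 2 + 1) / 2 * (ε ^ 2 / s) + -((s / ε - 1 / 2) * ε) =
      -(s / 2) + ε / 2 - ε ^ 2 / (8 * s) := by
    field_simp
    ring
  have h3 : 0 ≤ ε ^ 2 / (8 * s) := by positivity
  linarith

end Privacy

/-! ### Second moment of the noise -/

theorem integral_sq_mul_laplaceDensity {β : ℝ} (hβ : 0 < β) :
    ∫ y : ℝ, y ^ 2 * (β / 2 * Real.exp (-(β * |y|))) = 2 / β ^ 2 := by
  have h1 : (fun y : ℝ => y ^ 2 * (β / 2 * Real.exp (-(β * |y|)))) =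
      fun y : ℝ => (fun z : ℝ => z ^ 2 * (β / 2 * Real.exp (-(β * z)))) |y| := by
    funext y; simp
  rw [h1, integral_comp_abs (f := fun z : ℝ => z ^ 2 * (β / 2 * Real.exp (-(β * z))))]
  have h2 := Real.integral_rpow_mul_exp_neg_mul_Ioi (a := 3) (by norm_num) hβ
  have h3 : ∫ z in Set.Ioi (0 : ℝ), z ^ 2 * (β / 2 * Real.exp (-(β * z))) =
      β / 2 * ∫ z in Set.Ioi (0 : ℝ), z ^ ((3 : ℝ) - 1) * Real.exp (-(β * z)) := by
    rw [← integral_const_mul]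
    refine setIntegral_congr_fun measurableSet_Ioi fun z _ => ?_
    have : z ^ ((3 : ℝ) - 1) = z ^ 2 := by rw [← Real.rpow_natCast]; norm_num
    simp only [this]
    ring
  have h4 : Real.Gamma 3 = 2 := by norm_num [Nat.factorial]
  rw [h3, h2, h4]
  have h5 : (1 / β) ^ (3 : ℝ) = (1 / β) ^ 3 := by rw [← Real.rpow_natCast]; norm_num
  rw [h5]
  field_simp

theorem lintegral_sq_laplace {β : ℝ} (hβ : 0 < β) :
    ∫⁻ y, ENNReal.ofReal (y ^ 2) ∂laplaceMeasure β = ENNReal.ofReal (2 / β ^ 2) := by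
  have hI := integral_sq_mul_laplaceDensity hβ
  have hint : Integrable fun y : ℝ => y ^ 2 * (β / 2 * Real.exp (-(β * |y|))) := by
    -- A function that is not integrable has integral `0` by convention, while the value here is
    -- positive.
    by_contra hni
    rw [integral_undef hni] at hI
    have : 0 < 2 / β ^ 2 := by positivity
    linarith
  rw [← hI, ofReal_integral_eq_lintegral_ofReal hint (ae_of_all _ fun y => by positivity),
    laplaceMeasure, lintegral_withDensity_eq_lintegral_mul _ (measurable_laplaceDensity β)
      (by fun_prop)]
  refine lintegral_congr fun y => ?_
  rw [Pi.mul_apply, mul_comm, ENNReal.ofReal_mul (sq_nonneg y)]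

theorem integrable_sq_laplace {β : ℝ} (hβ : 0 < β) :
    Integrable (fun y : ℝ => y ^ 2) (laplaceMeasure β) := by
  refine ⟨by fun_prop, ?_⟩
  rw [hasFiniteIntegral_iff_ofReal (ae_of_all _ fun y => sq_nonneg y), lintegral_sq_laplace hβ]
  exact ENNReal.ofReal_lt_top

theorem integral_sq_laplace {β : ℝ} (hβ : 0 < β) :
    ∫ y, y ^ 2 ∂laplaceMeasure β = 2 / β ^ 2 := by
  rw [integral_eq_lintegral_of_nonneg_ae (ae_of_all _ fun y => sq_nonneg y) (by fun_prop),
    lintegral_sq_laplace hβ, ENNReal.toReal_ofReal (by positivity)]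

/-! ### Expected error of a run. -/

section Utility

variable {N d q : ℕ} {Ω : Type*} [MeasurableSpace Ω] {μ : Measure Ω}
  {m D σ : Fin N → ℝ} {α ρ₀ ζ p θ : ℝ} {β : Fin N → ℝ} {x0 : Ω → Fin N → Vec d}
  {ρ : Ω → ℕ → Fin N → Fin q → ℝ} {noise : Ω → ℕ → Fin N → Vec d}
  {A : Fin N → Vec d →L[ℝ] Vec q} {c : Vec q} {f : Fin N → Vec d → ℝ}

theorem IsLaplaceRun.integrable_norm_sq (h : IsLaplaceRun μ m D σ α ρ₀ β x0 ρ noise)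
    (hβ : ∀ i, 0 < β i) (k : ℕ) (i : Fin N) :
    Integrable (fun ω => ‖noise ω k i‖ ^ 2) μ ∧
      ∫ ω, ‖noise ω k i‖ ^ 2 ∂μ = d * (2 / β i ^ 2) := by
  have hm := fun l => (h.measurable_coord k i l).aemeasurable (μ := μ)
  have h1 : ∀ l, Integrable (fun ω => noise ω k i l ^ 2) μ := fun l => by
    have := integrable_sq_laplace (hβ i)
    rw [← h.law k i l] at this
    exact this.comp_aemeasurable (hm l)
  have h2 : ∀ l, ∫ ω, noise ω k i l ^ 2 ∂μ = 2 / β i ^ 2 := fun l => by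
    rw [← integral_sq_laplace (hβ i), ← h.law k i l, integral_map (hm l) (by fun_prop)]
  simp only [EuclideanSpace.real_norm_sq_eq]
  refine ⟨integrable_finsetSum _ fun l _ => h1 l, ?_⟩
  rw [integral_finsetSum _ fun l _ => h1 l]
  simp [h2]

theorem IsLaplaceRun.integrable_residual (h : IsLaplaceRun μ m D σ α ρ₀ β x0 ρ noise)
    (hβ : ∀ i, 0 < β i) (K : ℕ) :
    Integrable (fun ω => residual A D ζ p θ (noise ω) K) μ ∧
      ∫ ω, residual A D ζ p θ (noise ω) K ∂μ = ∑ i, noiseCoeff A D ζ p θ i *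
        ∑ j ∈ Finset.Icc 1 K, rate p θ ^ j * (d * (2 / β i ^ 2)) := by
  have h1 := fun k i => (h.integrable_norm_sq hβ k i).1
  have h2 : ∀ i, Integrable (fun ω => ∑ j ∈ Finset.Icc 1 K,
      rate p θ ^ j * ‖noise ω (K + 1 - j) i‖ ^ 2) μ := fun i =>
    integrable_finsetSum _ fun j _ => (h1 _ i).const_mul _
  unfold residual
  refine ⟨integrable_finsetSum _ fun i _ => (h2 i).const_mul _, ?_⟩
  rw [integral_finsetSum _ fun i _ => (h2 i).const_mul _]
  refine Finset.sum_congr rfl fun i _ => ?_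
  rw [integral_const_mul, integral_finsetSum _ fun j _ => (h1 _ i).const_mul _]
  congr 1
  refine Finset.sum_congr rfl fun j _ => ?_
  rw [integral_const_mul, (h.integrable_norm_sq hβ _ i).2]

theorem sum_Icc_pow_le {a : ℝ} (ha : a ∈ Set.Ioo (0 : ℝ) 1) (K : ℕ) :
    ∑ j ∈ Finset.Icc 1 K, a ^ j ≤ a / (1 - a) := by
  have h := sum_Icc_one_eq_sum_range a (fun _ => 1) K
  simp only [mul_one] at h
  have h1 : 0 < 1 - a := by linarith [ha.2]
  rw [h, le_div_iff₀ h1]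
  simp only [pow_succ]
  rw [← Finset.sum_mul]
  have h2 := geom_sum_mul_neg a K
  have h3 : 0 ≤ a ^ K := pow_nonneg ha.1.le K
  nlinarith [ha.1]

theorem lossConst_nonneg (hDp : ∀ i, 0 < D i) (hζ : 0 < ζ) (hp : 0 < p) (hθ0 : 0 < θ)
    (hθ : θ < 1) : 0 ≤ lossConst A D ζ p θ := by
  have ha := rate_mem_Ioo hp hθ
  refine mul_nonneg (mul_nonneg zero_le_two (div_nonneg ha.1.le (by linarith [ha.2])))
    (Real.iSup_nonneg fun i => ?_)
  have := hDp i
  positivity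

/-- Because `βᵢ` is proportional to `Dᵢ`, the variance cancels the factor `Dᵢ²` of the noise
coefficient. This leaves the bracket maximized in `lossConst`, once for each of the `N` agents. -/
theorem expected_residual_le (hDp : ∀ i, 0 < D i) (hp : 0 < p) (hθ : θ < 1) {T : ℝ} (hT : 0 ≤ T)
    (hβT : ∀ i, d * (2 / β i ^ 2) = T / D i ^ 2) (hζ : 0 < ζ) (hθ0 : 0 < θ) (K : ℕ) :
    ∑ i, noiseCoeff A D ζ p θ i * ∑ j ∈ Finset.Icc 1 K, rate p θ ^ j * (d * (2 / β i ^ 2)) ≤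
      lossConst A D ζ p θ * (N * T / 2) := by
  have ha := rate_mem_Ioo hp hθ
  set S : ℝ := ⨆ i, (6 * p / (ζ * N * sigmaMin (A i) ^ 2) + 1 / (θ * p * D i)) with hS
  have hterm : ∀ i, noiseCoeff A D ζ p θ i *
      ∑ j ∈ Finset.Icc 1 K, rate p θ ^ j * (d * (2 / β i ^ 2)) ≤
      S * (T * (rate p θ / (1 - rate p θ))) := by
    intro i
    have hDi := hDp i
    have e : noiseCoeff A D ζ p θ i = D i ^ 2 *
        (6 * p / (ζ * N * sigmaMin (A i) ^ 2) + 1 / (θ * p * D i)) := by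
      rw [noiseCoeff, mul_add]
      congr 1
      · ring
      · field_simp
    have hle : 6 * p / (ζ * N * sigmaMin (A i) ^ 2) + 1 / (θ * p * D i) ≤ S :=
      le_ciSup (f := fun i => 6 * p / (ζ * N * sigmaMin (A i) ^ 2) + 1 / (θ * p * D i))
        (Set.finite_range _).bddAbove i
    have hpos : 0 ≤ 6 * p / (ζ * N * sigmaMin (A i) ^ 2) + 1 / (θ * p * D i) := by positivity
    rw [← Finset.sum_mul, hβT i, e]
    have hgeo := sum_Icc_pow_le ha K
    have hgeo0 : 0 ≤ ∑ j ∈ Finset.Icc 1 K, rate p θ ^ j :=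
      Finset.sum_nonneg fun j _ => pow_nonneg ha.1.le j
    calc _ = (6 * p / (ζ * N * sigmaMin (A i) ^ 2) + 1 / (θ * p * D i)) *
          (T * ∑ j ∈ Finset.Icc 1 K, rate p θ ^ j) := by
          field_simp
      _ ≤ _ := by
          have := hpos.trans hle
          gcongr
  refine (Finset.sum_le_sum fun i _ => hterm i).trans_eq ?_
  rw [Finset.sum_const, Finset.card_univ, Fintype.card_fin, nsmul_eq_mul, lossConst, ← hS]
  ring

theorem measurable_gNormSq {Dc : Fin N → ℝ} : Measurable (gNormSq (d := d) (q := q) Dc ζ) := by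
  unfold gNormSq; fun_prop

theorem measurable_l2NormSq : Measurable (l2NormSq (N := N) (d := d) (q := q)) := by
  unfold l2NormSq; fun_prop

theorem l2NormSq_nonneg (u : State N d q) : 0 ≤ l2NormSq u := by
  unfold l2NormSq; positivity

theorem l2NormSq_le (hDp : ∀ i, 0 < D i) (hζ : 0 < ζ) (u : State N d q) :
    l2NormSq u ≤ max ζ (⨆ i, 1 / D i) * gNormSq D ζ u := by
  set C := max ζ (⨆ i, 1 / D i) with hC
  have h1 : ζ ≤ C := le_max_left _ _
  have h2 : ∀ i, 1 / D i ≤ C := fun i =>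
    (le_ciSup (f := fun i => 1 / D i) (Set.finite_range _).bddAbove i).trans (le_max_right _ _)
  unfold l2NormSq gNormSq
  rw [mul_add, Finset.mul_sum]
  refine add_le_add (Finset.sum_le_sum fun i _ => ?_) ?_
  · have := h2 i
    rw [div_le_iff₀ (hDp i)] at this
    nlinarith [sq_nonneg ‖u.1 i‖]
  · rw [← mul_assoc, ← div_eq_mul_inv]
    exact le_mul_of_one_le_left (sq_nonneg _) ((one_le_div hζ).2 h1)

theorem expected_error_le (h : IsLaplaceRun μ m D σ α ρ₀ β x0 ρ noise) (hDp : ∀ i, 0 < D i)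
    (hβ : ∀ i, 0 < β i) (hζ : 0 < ζ) (hp : 0 < p) (hθ0 : 0 < θ) (hθ : θ < 1)
    (hf : ∀ i, Continuous (gradient (f i))) {us : State N d q} {lam0 : Vec q} {T : ℝ}
    (hT : 0 ≤ T) (hβT : ∀ i, d * (2 / β i ^ 2) = T / D i ^ 2) {K : ℕ}
    (hiter : ∀ x0 ρ noise, (∀ k, Admissible m D σ α ρ₀ (ρ (k + 1))) →
      gNormSq D ζ (iter A c D ζ f ρ noise (x0, lam0) K - us) ≤
        rate p θ ^ K * gNormSq D ζ ((x0, lam0) - us) + residual A D ζ p θ noise K)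
    (hint : Integrable (fun ω => gNormSq D ζ ((x0 ω, lam0) - us)) μ) :
    Integrable (fun ω =>
        gNormSq D ζ (iter A c D ζ f (ρ ω) (noise ω) (x0 ω, lam0) K - us)) μ ∧
      Integrable (fun ω =>
        l2NormSq (iter A c D ζ f (ρ ω) (noise ω) (x0 ω, lam0) K - us)) μ ∧
      ∫ ω, gNormSq D ζ (iter A c D ζ f (ρ ω) (noise ω) (x0 ω, lam0) K - us) ∂μ ≤
        rate p θ ^ K * ∫ ω, gNormSq D ζ ((x0 ω, lam0) - us) ∂μ +
          lossConst A D ζ p θ * (N * T / 2) ∧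
      ∫ ω, l2NormSq (iter A c D ζ f (ρ ω) (noise ω) (x0 ω, lam0) K - us) ∂μ ≤
        max ζ (⨆ i, 1 / D i) *
          ∫ ω, gNormSq D ζ (iter A c D ζ f (ρ ω) (noise ω) (x0 ω, lam0) K - us) ∂μ := by
  have hmeas : Measurable fun ω => iter A c D ζ f (ρ ω) (noise ω) (x0 ω, lam0) K - us :=
    (measurable_iter hf h.measurable_ρ h.measurable_noise
      (h.measurable_x0.prodMk measurable_const) K).sub_const us
  obtain ⟨hR, hRint⟩ := h.integrable_residual (A := A) (ζ := ζ) (p := p) (θ := θ) hβ K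
  have hbound : ∀ᵐ ω ∂μ,
      gNormSq D ζ (iter A c D ζ f (ρ ω) (noise ω) (x0 ω, lam0) K - us) ≤
        rate p θ ^ K * gNormSq D ζ ((x0 ω, lam0) - us) + residual A D ζ p θ (noise ω) K := by
    filter_upwards [h.admissible] with ω hω using hiter _ _ _ hω
  have hB := (hint.const_mul (rate p θ ^ K)).add hR
  have hG : Integrable (fun ω =>
      gNormSq D ζ (iter A c D ζ f (ρ ω) (noise ω) (x0 ω, lam0) K - us)) μ := by
    refine hB.mono' (measurable_gNormSq.comp hmeas).aestronglyMeasurable ?_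
    filter_upwards [hbound] with ω hω
    rwa [Real.norm_of_nonneg (gNormSq_nonneg hDp hζ _)]
  have hL : Integrable (fun ω =>
      l2NormSq (iter A c D ζ f (ρ ω) (noise ω) (x0 ω, lam0) K - us)) μ := by
    refine (hG.const_mul (max ζ (⨆ i, 1 / D i))).mono'
      (measurable_l2NormSq.comp hmeas).aestronglyMeasurable (ae_of_all _ fun ω => ?_)
    rw [Real.norm_of_nonneg (l2NormSq_nonneg _)]
    exact l2NormSq_le hDp hζ _
  refine ⟨hG, hL, ?_, ?_⟩
  · refine (integral_mono_ae hG hB hbound).trans ?_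
    simp only [Pi.add_apply]
    rw [integral_add (hint.const_mul _) hR, integral_const_mul, hRint]
    gcongr
    exact expected_residual_le hDp hp hθ hT hβT hζ hθ0 K
  · rw [← integral_const_mul]
    exact integral_mono hL (hG.const_mul _) fun ω => l2NormSq_le hDp hζ _

end Utility

/-! ### The number of rounds -/

/-- The horizon is at least `log (1 + V / Y) / log (1 / a)`, so `a ^ K * (1 + V / Y) ≤ 1`. -/
theorem pow_horizon_mul_le {a V Y : ℝ} (ha : a ∈ Set.Ioo (0 : ℝ) 1) (hV : 0 ≤ V) (hY : 0 < Y) :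
    a ^ horizon a V Y * V ≤ Y := by
  have hlog : 0 < Real.log (1 / a) := Real.log_pos (by rw [lt_div_iff₀ ha.1]; linarith [ha.2])
  have hx : 0 < 1 + V / Y := by positivity
  have h1 : Real.log (1 + V / Y) / Real.log (1 / a) ≤ horizon a V Y := by
    refine (Nat.le_ceil _).trans ?_
    unfold horizon
    exact_mod_cast Nat.le_add_left _ _
  rw [div_le_iff₀ hlog, Real.log_le_iff_le_exp hx, one_div, Real.log_inv, mul_neg, Real.exp_neg,
    ← Real.log_pow, Real.exp_log (pow_pos ha.1 _), ← one_div, le_div_iff₀ (pow_pos ha.1 _)] at h1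
  have h2 : a ^ horizon a V Y * V = (V / Y * a ^ horizon a V Y) * Y := by field_simp
  rw [h2]
  have := pow_pos ha.1 (horizon a V Y)
  nlinarith

theorem horizon_le {a V Y : ℝ} (ha : a ∈ Set.Ioo (0 : ℝ) 1) (hV : 0 ≤ V) (hY : 0 < Y) :
    (horizon a V Y : ℝ) ≤ (2 + 1 / Real.log (1 / a)) * (1 + Real.log (1 + V / Y)) := by
  have hlog : 0 < Real.log (1 / a) := Real.log_pos (by rw [lt_div_iff₀ ha.1]; linarith [ha.2])
  have hL : 0 ≤ Real.log (1 + V / Y) := Real.log_nonneg (by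
    have : 0 ≤ V / Y := by positivity
    linarith)
  have h1 := (Nat.ceil_lt_add_one (div_nonneg hL hlog.le)).le
  have e : (2 + 1 / Real.log (1 / a)) * (1 + Real.log (1 + V / Y)) =
      1 + (Real.log (1 + V / Y) / Real.log (1 / a) + 1) +
        (2 * Real.log (1 + V / Y) + 1 / Real.log (1 / a)) := by
    field_simp
    ring
  have h2 : 0 ≤ 1 / Real.log (1 / a) := by positivity
  rw [e]
  unfold horizon
  push_cast
  linarith

/-- At the horizon the initial error has shrunk to `Y ≤ W Y`, so it merges with the noise term into
`(1 + Θ) W Y`. Here `W` carries the power of `K` and, for approximate privacy, the factor `s`. -/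
theorem error_at_horizon_le {N d q : ℕ} {A : Fin N → Vec d →L[ℝ] Vec q} {D : Fin N → ℝ}
    {ζ p θ E E0 V Y W X : ℝ} {K : ℕ} (e : ℕ) (hDp : ∀ i, 0 < D i) (hζ : 0 < ζ) (hp : 0 < p)
    (hθ0 : 0 < θ) (hθ : θ < 1) (hY : 0 < Y) (hE0 : 0 ≤ E0) (hV : E0 ≤ V)
    (hK : K = horizon (rate p θ) V Y) (hE : E ≤ rate p θ ^ K * E0 + lossConst A D ζ p θ * W * Y)
    (hW1 : 1 ≤ W)
    (hW : W ≤ (2 + 1 / Real.log (1 / rate p θ)) ^ e * X) :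
    max ζ (⨆ i, 1 / D i) * E ≤ softConst A D ζ p θ e * X * Y := by
  have ha := rate_mem_Ioo hp hθ
  have hΘ := lossConst_nonneg (A := A) hDp hζ hp hθ0 hθ
  have hM : 0 ≤ max ζ (⨆ i, 1 / D i) := hζ.le.trans (le_max_left _ _)
  have h1 : rate p θ ^ K * E0 ≤ Y := hK ▸
    (mul_le_mul_of_nonneg_left hV (pow_nonneg ha.1.le _)).trans
      (pow_horizon_mul_le ha (hE0.trans hV) hY)
  calc max ζ (⨆ i, 1 / D i) * E
      ≤ max ζ (⨆ i, 1 / D i) * (Y + lossConst A D ζ p θ * W * Y) := by gcongr; linarith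
    _ ≤ max ζ (⨆ i, 1 / D i) * (W * Y + lossConst A D ζ p θ * W * Y) := by
        gcongr
        exact le_mul_of_one_le_left hY.le hW1
    _ = max ζ (⨆ i, 1 / D i) * (1 + lossConst A D ζ p θ) * W * Y := by ring
    _ ≤ max ζ (⨆ i, 1 / D i) * (1 + lossConst A D ζ p θ) *
        ((2 + 1 / Real.log (1 / rate p θ)) ^ e * X) * Y := by gcongr
    _ = _ := by rw [softConst]; ring

end PrivateADMM

end

/-! ### Assembly of convergence, privacy and utility. -/

theorem theorem3p3
    (N : ℕ) (hN : 1 ≤ N) (m M D σ : Fin N → ℝ) (α ρ₀ ζ τ : ℝ)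
    (hm : ∀ i, 0 < m i) (hα : 0 < α) (hρ₀ : 0 < ρ₀) (hζ : 0 < ζ) (hτ : 0 < τ)
    (hD : ∀ i, N * σ i ^ 2 / α + √(M i) < D i)
    (hαρ : N / (2 * α) < ρ₀) (hζρ : ζ < 2 * ρ₀ - N / α) :
    -- `p` depends on the scalar constants above only, in particular not on `d`
    ∃ p : ℝ, 0 < p ∧ ∀ θ : ℝ, 0 < θ → θ < 1 →
      ∀ (d q : ℕ), 1 ≤ d → ∀ (A : Fin N → Vec d →L[ℝ] Vec q), (∀ i, ‖A i‖ = σ i) →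
      -- `τ` is a lower bound for the squares of the nonzero singular values of `[A₁ ⋯ A_N]`
      (∀ v ∈ (⨆ i, LinearMap.range (A i : Vec d →ₗ[ℝ] Vec q)),
        τ * ‖v‖ ^ 2 ≤ ∑ i, ‖ContinuousLinearMap.adjoint (A i) v‖ ^ 2) →
      ∀ (c lam0 : Vec q),
      -- convergence for arbitrary noise
      (∀ f : Fin N → Vec d → ℝ, (∀ i, StronglyConvexSmooth (m i) (M i) (f i)) →
        ∀ us : State N d q, IsOptimum A c f us →
          lam0 - us.2 ∈ (⨆ i, LinearMap.range (A i : Vec d →ₗ[ℝ] Vec q)) →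
        ∀ (x0 : Fin N → Vec d) (ρ : ℕ → Fin N → Fin q → ℝ) (noise : ℕ → Fin N → Vec d),
          (∀ k, Admissible m D σ α ρ₀ (ρ (k + 1))) →
          (rate p θ ∈ Set.Ioo (0 : ℝ) 1 ∧
            ∀ k, gNormSq D ζ (iter A c D ζ f ρ noise (x0, lam0) k - us) ≤
              rate p θ ^ k * gNormSq D ζ ((x0, lam0) - us) + residual A D ζ p θ noise k) ∧
          ((∀ i, Tendsto (fun k => noise k i) atTop (𝓝 0)) →
            Tendsto (fun k => residual A D ζ p θ noise k) atTop (𝓝 0))) ∧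
      -- privacy and utility
      (∀ (F : Fin N → Set (Vec d → ℝ)) (B ε : ℝ), 0 < B → 0 < ε →
        (∀ i, ∀ f ∈ F i, StronglyConvexSmooth (m i) (M i) f) → HasSensitivity F B →
        ∀ (Ω : Type*) [MeasurableSpace Ω] (μ : Measure Ω) [IsProbabilityMeasure μ]
          (x0 : Ω → Fin N → Vec d) (ρ : Ω → ℕ → Fin N → Fin q → ℝ)
          (noise : Ω → ℕ → Fin N → Vec d) (K : ℕ), 1 ≤ K →
        -- pure `ε`-LDP
        (IsLaplaceRun μ m D σ α ρ₀ (fun i => ε * D i / (B * K * d)) x0 ρ noise →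
          IsLDP μ F (transcript A c D ζ lam0 K x0 ρ noise) ε 0 ∧
          ∀ f : Fin N → Vec d → ℝ, (∀ i, f i ∈ F i) →
          ∀ us : State N d q, IsOptimum A c f us →
            lam0 - us.2 ∈ (⨆ i, LinearMap.range (A i : Vec d →ₗ[ℝ] Vec q)) →
          Integrable (fun ω => gNormSq D ζ ((x0 ω, lam0) - us)) μ →
          Integrable (fun ω =>
            gNormSq D ζ (iter A c D ζ f (ρ ω) (noise ω) (x0 ω, lam0) K - us)) μ ∧
          Integrable (fun ω =>
            l2NormSq (iter A c D ζ f (ρ ω) (noise ω) (x0 ω, lam0) K - us)) μ ∧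
          ∫ ω, gNormSq D ζ (iter A c D ζ f (ρ ω) (noise ω) (x0 ω, lam0) K - us) ∂μ ≤
            rate p θ ^ K * ∫ ω, gNormSq D ζ ((x0 ω, lam0) - us) ∂μ +
              lossConst A D ζ p θ * K ^ 2 * (d ^ 3 * N * B ^ 2 / ε ^ 2) ∧
          ∀ V : ℝ, ∫ ω, gNormSq D ζ ((x0 ω, lam0) - us) ∂μ ≤ V →
            K = horizon (rate p θ) V (d ^ 3 * N * B ^ 2 / ε ^ 2) →
            ∫ ω, l2NormSq (iter A c D ζ f (ρ ω) (noise ω) (x0 ω, lam0) K - us) ∂μ ≤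
              softConst A D ζ p θ 2 * (d ^ 3 * N * B ^ 2 / ε ^ 2) *
                (1 + Real.log (1 + V / (d ^ 3 * N * B ^ 2 / ε ^ 2))) ^ 2) ∧
        -- `(ε, δ)`-LDP
        (∀ δ : ℝ, 0 < δ → δ < 1 → ε ≤ 1 →
          IsLaplaceRun μ m D σ α ρ₀
            (fun i => ε * D i / (B * √(K * d * (1 + 2 * Real.log (1 / δ))))) x0 ρ noise →
          IsLDP μ F (transcript A c D ζ lam0 K x0 ρ noise) ε δ ∧
          ∀ f : Fin N → Vec d → ℝ, (∀ i, f i ∈ F i) →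
          ∀ us : State N d q, IsOptimum A c f us →
            lam0 - us.2 ∈ (⨆ i, LinearMap.range (A i : Vec d →ₗ[ℝ] Vec q)) →
          Integrable (fun ω => gNormSq D ζ ((x0 ω, lam0) - us)) μ →
          Integrable (fun ω =>
            gNormSq D ζ (iter A c D ζ f (ρ ω) (noise ω) (x0 ω, lam0) K - us)) μ ∧
          Integrable (fun ω =>
            l2NormSq (iter A c D ζ f (ρ ω) (noise ω) (x0 ω, lam0) K - us)) μ ∧
          ∫ ω, gNormSq D ζ (iter A c D ζ f (ρ ω) (noise ω) (x0 ω, lam0) K - us) ∂μ ≤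
            rate p θ ^ K * ∫ ω, gNormSq D ζ ((x0 ω, lam0) - us) ∂μ +
              lossConst A D ζ p θ * (1 + 2 * Real.log (1 / δ)) * K *
                (d ^ 2 * N * B ^ 2 / ε ^ 2) ∧
          ∀ V : ℝ, ∫ ω, gNormSq D ζ ((x0 ω, lam0) - us) ∂μ ≤ V →
            K = horizon (rate p θ) V (d ^ 2 * N * B ^ 2 / ε ^ 2) →
            ∫ ω, l2NormSq (iter A c D ζ f (ρ ω) (noise ω) (x0 ω, lam0) K - us) ∂μ ≤
              softConst A D ζ p θ 1 * (1 + 2 * Real.log (1 / δ)) *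
                (d ^ 2 * N * B ^ 2 / ε ^ 2) *
                (1 + Real.log (1 + V / (d ^ 2 * N * B ^ 2 / ε ^ 2))))) := by
  have hDp := D_pos hα hD
  obtain ⟨p, hp, H⟩ := exists_contraction hN hm hα hζ hτ hD hζρ
  refine ⟨p, hp, fun θ hθ0 hθ d q hd A hA hτA c lam0 => ?_⟩
  have hconv : ∀ f : Fin N → Vec d → ℝ, (∀ i, StronglyConvexSmooth (m i) (M i) (f i)) →
      ∀ us : State N d q, IsOptimum A c f us →
        lam0 - us.2 ∈ (⨆ i, LinearMap.range (A i : Vec d →ₗ[ℝ] Vec q)) →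
      ∀ k x0 ρ noise, (∀ k, Admissible m D σ α ρ₀ (ρ (k + 1))) →
        gNormSq D ζ (iter A c D ζ f ρ noise (x0, lam0) k - us) ≤
          rate p θ ^ k * gNormSq D ζ ((x0, lam0) - us) + residual A D ζ p θ noise k :=
    fun f hf us hus hlam k x0 ρ noise hadm => iter_le hp hθ hus.feasible
      (fun k u hu => H θ hθ0 hθ d q A hA hτA c f hf us hus _ (hadm k) _ u hu) hlam k
  refine ⟨fun f hf us hus hlam x0 ρ noise hadm =>
    ⟨⟨rate_mem_Ioo hp hθ, fun k => hconv f hf us hus hlam k x0 ρ noise hadm⟩,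
      tendsto_residual hp hθ ζ⟩, ?_⟩
  intro F B ε hB hε hF hsens Ω _ μ _ x0 ρ noise K hK
  have hNpos : (0 : ℝ) < N := by exact_mod_cast hN
  have hdpos : (0 : ℝ) < d := by exact_mod_cast hd
  have hK1 : (1 : ℝ) ≤ K := by exact_mod_cast hK
  have hKpos : (0 : ℝ) < K := by linarith
  have hcont : ∀ f : Fin N → Vec d → ℝ, (∀ j, f j ∈ F j) → ∀ i, Continuous (gradient (f i)) :=
    fun f hf i => (hF i _ (hf i)).continuous_gradient
  have hupd : ∀ f : Fin N → Vec d → ℝ, (∀ j, f j ∈ F j) → ∀ i, ∀ g ∈ F i,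
      ∀ j, Function.update f i g j ∈ F j := by
    intro f hf i g hg j
    rcases eq_or_ne j i with rfl | hj
    · rwa [Function.update_self]
    · rw [Function.update_of_ne hj]; exact hf j
  constructor
  · intro hrun
    have hβ : ∀ i, 0 < ε * D i / (B * K * d) := fun i => by have := hDp i; positivity
    refine ⟨?_, ?_⟩
    · intro f hf i g hg S hS
      -- There are `K d` affected coordinates, each with loss at most `βᵢ B / Dᵢ = ε / (K d)`.
      have hbud : K * (d * (ε * D i / (B * K * d) * B / D i)) ≤ ε := by
        have := (hDp i).ne'
        exact le_of_eq (by field_simp)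
      rw [ENNReal.ofReal_zero, add_zero, add_zero]
      exact ⟨measure_transcript_le_pure hrun hβ (hcont f hf) (hcont _ (hupd f hf i g hg)) (hDp i)
          (fun j hj => Function.update_of_ne hj _ _)
          (fun x l => by rw [Function.update_self]; exact hsens i g hg _ (hf i) x l) hbud hS,
        measure_transcript_le_pure hrun hβ (hcont _ (hupd f hf i g hg)) (hcont f hf) (hDp i)
          (fun j hj => (Function.update_of_ne hj _ _).symm)
          (fun x l => by rw [Function.update_self]; exact hsens i _ (hf i) g hg x l) hbud hS⟩
    · intro f hf us hus hlam hint
      set Y : ℝ := d ^ 3 * N * B ^ 2 / ε ^ 2 with hY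
      have hYpos : 0 < Y := by positivity
      -- `T` is `Dᵢ²` times the second moment `2 d / βᵢ²` of the noise vector, which does not depend
      -- on `i`; then `N T / 2 = K² Y`.
      obtain ⟨h1, h2, h3, h4⟩ := expected_error_le (A := A) (c := c) (K := K)
        (T := 2 * d * (B * K * d) ^ 2 / ε ^ 2) hrun hDp hβ hζ hp hθ0 hθ (hcont f hf) (by positivity)
        (fun i => by
          have := (hDp i).ne'
          field_simp)
        (hconv f (fun i => hF i _ (hf i)) us hus hlam K) hint
      have e : N * (2 * d * (B * K * d) ^ 2 / ε ^ 2) / 2 = (K : ℝ) ^ 2 * Y := by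
        rw [hY]; ring
      rw [e, ← mul_assoc] at h3
      refine ⟨h1, h2, h3, fun V hV hKV => h4.trans ?_⟩
      have hE0 : 0 ≤ ∫ ω, gNormSq D ζ ((x0 ω, lam0) - us) ∂μ :=
        integral_nonneg fun ω => gNormSq_nonneg hDp hζ _
      have hKle : (K : ℝ) ≤ _ := hKV ▸ horizon_le (rate_mem_Ioo hp hθ) (hE0.trans hV) hYpos
      refine (error_at_horizon_le (Y := Y) (V := V) (W := (K : ℝ) ^ 2)
        (X := (1 + Real.log (1 + V / Y)) ^ 2) 2 hDp hζ hp hθ0 hθ hYpos hE0 hV hKV h3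
        (one_le_pow₀ hK1) ?_).trans_eq (by ring)
      rw [← mul_pow]
      gcongr
  · intro δ hδ0 hδ1 hε1 hrun
    set s : ℝ := 1 + 2 * Real.log (1 / δ) with hs
    have hlog : 0 < Real.log (1 / δ) := Real.log_pos (by rw [lt_div_iff₀ hδ0]; linarith)
    have hs1 : 1 ≤ s := by linarith
    have hspos : 0 < s := by linarith
    have hsq : √(K * d * s) ^ 2 = K * d * s := Real.sq_sqrt (by positivity)
    have hsqpos : 0 < √(K * d * s) := Real.sqrt_pos.2 (by positivity)
    have hβ : ∀ i, 0 < ε * D i / (B * √(K * d * s)) := fun i => by have := hDp i; positivity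
    refine ⟨?_, ?_⟩
    · intro f hf i g hg S hS
      -- The loss of a coordinate is at most `c = ε / √(K d s)`, so `K d s c² = ε²`: losses now add
      -- up in squares, which saves a factor of order `√(K d)` in the noise scale.
      have hbud : K * d * s * (ε * D i / (B * √(K * d * s)) * B / D i) ^ 2 ≤ ε ^ 2 := by
        have h1 : ε * D i / (B * √(K * d * s)) * B / D i = ε / √(K * d * s) := by
          have := (hDp i).ne'
          field_simp
        rw [h1, div_pow, hsq]
        exact le_of_eq (by field_simp)
      exact ⟨measure_transcript_le_approx hrun hβ (hcont f hf) (hcont _ (hupd f hf i g hg))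
          (hDp i) hB (fun j hj => Function.update_of_ne hj _ _)
          (fun x l => by rw [Function.update_self]; exact hsens i g hg _ (hf i) x l)
          hε hε1 hδ0 hδ1 hbud hS,
        measure_transcript_le_approx hrun hβ (hcont _ (hupd f hf i g hg)) (hcont f hf)
          (hDp i) hB (fun j hj => (Function.update_of_ne hj _ _).symm)
          (fun x l => by rw [Function.update_self]; exact hsens i _ (hf i) g hg x l)
          hε hε1 hδ0 hδ1 hbud hS⟩
    · intro f hf us hus hlam hint
      set Y : ℝ := d ^ 2 * N * B ^ 2 / ε ^ 2 with hY
      have hYpos : 0 < Y := by positivity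
      -- As before, `T` is `Dᵢ²` times `2 d / βᵢ²`; now `N T / 2 = s K Y`.
      obtain ⟨h1, h2, h3, h4⟩ := expected_error_le (A := A) (c := c) (K := K)
        (T := 2 * d * (B ^ 2 * (K * d * s)) / ε ^ 2) hrun hDp hβ hζ hp hθ0 hθ (hcont f hf)
        (by positivity)
        (fun i => by
          have := (hDp i).ne'
          rw [div_pow, mul_pow B, hsq]
          field_simp)
        (hconv f (fun i => hF i _ (hf i)) us hus hlam K) hint
      have e : N * (2 * d * (B ^ 2 * (K * d * s)) / ε ^ 2) / 2 = (s * K) * Y := by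
        rw [hY]; ring
      rw [e, ← mul_assoc] at h3
      refine ⟨h1, h2, by rwa [mul_assoc _ s], fun V hV hKV => h4.trans ?_⟩
      have hE0 : 0 ≤ ∫ ω, gNormSq D ζ ((x0 ω, lam0) - us) ∂μ :=
        integral_nonneg fun ω => gNormSq_nonneg hDp hζ _
      have hKle : (K : ℝ) ≤ _ := hKV ▸ horizon_le (rate_mem_Ioo hp hθ) (hE0.trans hV) hYpos
      refine (error_at_horizon_le (Y := Y) (V := V) (W := s * K)
        (X := s * (1 + Real.log (1 + V / Y))) 1 hDp hζ hp hθ0 hθ hYpos hE0 hV hKV h3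
        (one_le_mul_of_one_le_of_one_le hs1 hK1) ?_).trans_eq (by ring)
      rw [pow_one, mul_left_comm]
      gcongr
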